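/- Let $T=[v_1,v_2,v_3]\subset\mathbb{R}^2$ be a nondegenerate closed triangle, and put $v_4=\frac{v_1+v_2}2$, $v_5=\frac{v_2+v_3}2$, $v_6=\frac{v_1+v_3}2$, $v_7=\frac{v_4+v_6}2$, $v_8=\frac{v_4+v_5}2$, $v_9=\frac{v_5+v_6}2$, $v_{10}=\frac{v_1+v_2+v_3}3$. The segments joining $v_1,\dots,v_6$ pairwise cut $T$ into twelve triangular faces (the Powell–Sabin 12-split). Assign every point of $T$ to exactly one of the closed faces containing it, and call the set of points assigned to a face the corresponding half-open face. Let $\mathcal S^3_5$ be the space of functions that are $C^3$ on $T$ and a polynomial of degree at most $5$ on each face. For a finite multiset $K$ of points of $\{v_1,\dots,v_{10}\}$ let $[K]$ be its convex hull and $[K)$ the union of the half-open faces whose closed faces lie in $[K]$. The simplex spline $Q[K]$ is $0$ if $\mathrm{area}[K]=0$; otherwise it is $\frac{\mathrm{area}(T)}{\mathrm{area}[K]}\mathbf 1_{[K)}$ if $|K|=3$, and $Q[K](x)=\sum_j\beta_j\,Q[K\setminus v_j](x)$ if $|K|>3$, where $x=\sum_j\beta_jv_j$, $\sum_j\beta_j=1$,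 and $\beta_j=0$ for $v_j\notin K$. (The bases below use only knots $v_1,\dots,v_6$. On $T$ their members depend neither on the assignment of points to faces nor on the choice of the $\beta_j$.) Write $Q_{ijklmn}:=Q[v_1^iv_2^jv_3^kv_4^lv_5^mv_6^n]$. Let $c_1,c_2,c_3$ be indeterminates and let $c_4,\dots,c_{10}$ be formed from them as $v_4,\dots,v_{10}$ are formed from $v_1,v_2,v_3$. The following list gives a label, a simplex spline, and a weight times a dual polynomial: - a: $Q_{600101}$, $\frac14c_1^5$; b: $Q_{500201}$, $\frac14c_1^4c_4$; e: $Q_{410201}$, $\frac12c_1^3c_4^2$; f: $Q_{320201}$, $\frac12c_1^2c_2c_4^2$; - g: $Q_{220211}$, $\frac34c_1c_2c_4^2c_{10}$; g′: $Q_{220211}$, $\frac14c_1c_2c_3c_4^2$; l: $Q_{141110}$, $c_2^3c_4c_5$; - n: $Q_{222110}$, $\frac34c_1c_2^2c_3c_{10}$; o: $Q_{221111}$, $\frac34c_1c_2c_3c_4c_{10}$; q: $Q_{321200}$, $c_1^2c_2c_4^2$; r: $Q_{131210}$, $\frac12c_1c_2^2c_4c_5$; - s: $Q_{221210}$, $\frac34c_1c_2^2c_4c_{10}$;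 s′: $Q_{221210}$, $\frac14c_1c_2^2c_3c_4$; t: $Q_{121211}$, $\frac34c_1c_2c_4c_5c_{10}$; t′: $Q_{121211}$, $\frac12c_1c_2c_3c_4c_8$. The bases $\mathcal B_a,\dots,\mathcal B_f$ consist of the orbits, under all permutations of $v_1,v_2,v_3$ (acting simultaneously on knots and dual polynomials, and keeping the weights), of the rows abeflnrs, abeflors, abefglrt, abelnqrs′, abeloqrs′ and abeg′lqrt′, respectively. Each orbit union has 39 members; the corresponding basis functions $S_1,\dots,S_{39}$ are the weights times the simplex splines. The domain point $\xi_i$ of $S_i$ is the average of the five points obtained by replacing each factor $c_j$ of its dual polynomial by $v_j$ (with multiplicity). Fix one of these bases $\mathcal B_\star$ and write $f=S^Tc=\sum_{i=1}^{39}c_iS_i$ for $c\in\mathbb R^{39}$. Call $K>0$ a stability constant of $\mathcal B_\star$ if $K^{-1}\|c\|_\infty\le\|f\|_{L_\infty(T)}\le\|c\|_\infty$ for all nondegenerate triangles $T$ and all $c\in\mathbb R^{39}$. **Corollary.** (i) For every nondegenerate triangle $T$ the collocation matrix $M_\star=(S_j(\xi_i))_{i,j}$ is nonsingular, the number $\|M_\star^{-1}\|_\infty$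 (maximal absolute row sum) is the same for all nondegenerate $T$, and it is a stability constant of $\mathcal B_\star$. (ii) Let $K_\star$ be any stability constant of $\mathcal B_\star$, in particular $K_\star=\|M_\star^{-1}\|_\infty$. For every nondegenerate triangle $T$ with longest edge $h$ and every $c\in\mathbb R^{39}$, the spline $f=S^Tc$ lies in $\mathcal S^3_5$, and with $H(x)$ the Hessian matrix of $f|_T$ at $x$ (one-sided on the boundary), the maximum of $\|H(x)\|_\infty$ (maximal absolute row sum) over $x\in T$ exists and $$\max_{1\le i\le 39}|c_i-f(\xi_i)|\le 2K_\star h^2\max_{x\in T}\|H(x)\|_\infty .$$ -/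

import Mathlib

open MeasureTheory

attribute [local instance] Matrix.linftyOpNormedAddCommGroup

namespace PS12

/-- The Euclidean plane. -/
abbrev Plane := EuclideanSpace ℝ (Fin 2)

/-! ### The Powell-Sabin 12-split of the triangle with vertices `v 0, v 1, v 2`

The mathematical labels `1, ..., 10` of the vertices of the split are `0, ..., 9` here. -/

/-- The (closed) macrotriangle. -/
def triangle (v : Fin 3 → Plane) : Set Plane := convexHull ℝ (Set.range v)

/-- The ten vertices of the 12-split: the three corners, the midpoints of the edges
`[v₁, v₂]`, `[v₂, v₃]`, `[v₁, v₃]`, the midpoints of `[v₄, v₆]`, `[v₄, v₅]`, `[v₅, v₆]`,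
and the barycentre. -/
noncomputable def vertex (v : Fin 3 → Plane) : Fin 10 → Plane :=
  ![v 0, v 1, v 2,
    (1 / 2 : ℝ) • (v 0 + v 1), (1 / 2 : ℝ) • (v 1 + v 2), (1 / 2 : ℝ) • (v 0 + v 2),
    (1 / 4 : ℝ) • ((v 0 + v 1) + (v 0 + v 2)),
    (1 / 4 : ℝ) • ((v 0 + v 1) + (v 1 + v 2)),
    (1 / 4 : ℝ) • ((v 1 + v 2) + (v 0 + v 2)),
    (1 / 3 : ℝ) • (v 0 + v 1 + v 2)]

/-- The vertex labels of the twelve faces of the split. -/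
def faceVertices : Fin 12 → Finset (Fin 10) :=
  ![{0, 5, 6}, {0, 3, 6}, {1, 3, 7}, {1, 4, 7}, {2, 4, 8}, {2, 5, 8},
    {5, 6, 9}, {3, 6, 9}, {3, 7, 9}, {4, 7, 9}, {4, 8, 9}, {5, 8, 9}]

/-- The closed faces of the 12-split. -/
def face (v : Fin 3 → Plane) (k : Fin 12) : Set Plane :=
  convexHull ℝ (vertex v '' (faceVertices k : Set (Fin 10)))

/-- The half-open faces: every point of the macrotriangle is assigned to exactly one face, namely
the first closed face that contains it. -/
def halfOpenFace (v : Fin 3 → Plane) (k : Fin 12) : Set Plane :=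
  {x | x ∈ face v k ∧ ∀ l < k, x ∉ face v l}

/-- The `C³` quintic splines on the 12-split. -/
def splineSpace (v : Fin 3 → Plane) : Set (Plane → ℝ) :=
  {f | ContDiffOn ℝ 3 f (triangle v) ∧
    ∀ k : Fin 12, ∃ p : MvPolynomial (Fin 2) ℝ, p.totalDegree ≤ 5 ∧
      ∀ x ∈ face v k, f x = MvPolynomial.eval (fun i => x i) p}

/-! ### Simplex splines

A knot multiset `{v₁^{m₁} ⋯ v₁₀^{m₁₀}}` is given by its multiplicities `m : Fin 10 → ℕ`. -/

/-- The convex hull `[K]`. -/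
def hull (v : Fin 3 → Plane) (m : Fin 10 → ℕ) : Set Plane :=
  convexHull ℝ (vertex v '' {j | m j ≠ 0})

/-- The half-open convex hull `[K)`: the union of the half-open faces whose closed face lies
in `[K]`. -/
def halfOpenHull (v : Fin 3 → Plane) (m : Fin 10 → ℕ) : Set Plane :=
  ⋃ k ∈ {k : Fin 12 | face v k ⊆ hull v m}, halfOpenFace v k

/-- The area of a plane set. -/
noncomputable def area (s : Set Plane) : ℝ := (volume s).toReal

/-- Twice the signed area of the triangle `p, q, r`. -/
def orient (p q r : Plane) : ℝ :=
  (q 0 - p 0) * (r 1 - p 1) - (q 1 - p 1) * (r 0 - p 0)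

/-- The increasing triples of labels, in lexicographic order. -/
def triples : List (Fin 10 × Fin 10 × Fin 10) :=
  ((List.finRange 10).flatMap fun i => (List.finRange 10).flatMap fun j =>
    (List.finRange 10).map fun k => (i, j, k)).filter fun t => t.1 < t.2.1 ∧ t.2.1 < t.2.2

open Classical in
/-- The first triple of labels of knots (all of positive multiplicity) that are not collinear,
if there is one. -/
noncomputable def knotTriple (v : Fin 3 → Plane) (m : Fin 10 → ℕ) :
    Option (Fin 10 × Fin 10 × Fin 10) :=
  triples.find? fun t => m t.1 ≠ 0 ∧ m t.2.1 ≠ 0 ∧ m t.2.2 ≠ 0 ∧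
    orient (vertex v t.1) (vertex v t.2.1) (vertex v t.2.2) ≠ 0

/-- Coefficients `β₁, ..., β₁₀` with `x = ∑ βⱼ vⱼ`, `∑ βⱼ = 1` and `βⱼ = 0` whenever `mⱼ = 0`
(see `knotCoeff_spec`): the barycentric coordinates of `x` with respect to the first triple of
non-collinear knots. -/
noncomputable def knotCoeff (v : Fin 3 → Plane) (m : Fin 10 → ℕ) (x : Plane) : Fin 10 → ℝ :=
  match knotTriple v m with
  | none => 0
  | some (i, j, k) =>
      let p := vertex v i
      let q := vertex v j
      let r := vertex v k
      Pi.single i (orient x q r / orient p q r) + Pi.single j (orient p x r / orient p q r) +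
        Pi.single k (orient p q x / orient p q r)

open Classical in
/-- The (area normalized) simplex spline `Q[K]` of degree `d`, for a knot multiset `K` with
`d + 3` elements, by recursion on the degree. -/
noncomputable def simplexSpline (v : Fin 3 → Plane) : ℕ → (Fin 10 → ℕ) → Plane → ℝ
  | 0, m, x =>
      if area (hull v m) = 0 then 0
      else (halfOpenHull v m).indicator (fun _ => area (triangle v) / area (hull v m)) x
  | d + 1, m, x =>
      if area (hull v m) = 0 then 0
      else ∑ j, knotCoeff v m x j * simplexSpline v d (m - Pi.single j 1) x

/-! ### Symmetries -/

/-- The permutation of the ten vertices of the split induced by a permutation `σ` of the three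
corners. -/
def vertexPerm (σ : Equiv.Perm (Fin 3)) : Fin 10 → Fin 10 :=
  let corner : Fin 3 → Fin 10 := ![0, 1, 2]
  -- the midpoint of the edge opposite to a corner
  let opposite : Fin 3 → Fin 10 := ![4, 5, 3]
  -- the midpoint of the segment that cuts off a corner
  let near : Fin 3 → Fin 10 := ![6, 7, 8]
  ![corner (σ 0), corner (σ 1), corner (σ 2),
    opposite (σ 2), opposite (σ 0), opposite (σ 1),
    near (σ 0), near (σ 1), near (σ 2), 9]

/-- The image of a multiset of vertices, given by its multiplicities, under a permutation of
the corners. -/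
def permute (σ : Equiv.Perm (Fin 3)) (m : Fin 10 → ℕ) : Fin 10 → ℕ :=
  fun j => m (vertexPerm σ⁻¹ j)

/-! ### The six bases -/

/-- A weighted simplex spline `w Q[K]` with its dual polynomial: the knot multiset `K`, the
weight `w` and the multiset of the five dual points. A product `c₁^{n₁} ⋯ c₁₀^{n₁₀}` of linear
forms stands for the dual points `{v₁^{n₁} ⋯ v₁₀^{n₁₀}}`. -/
abbrev Entry := (Fin 10 → ℕ) × ℚ × (Fin 10 → ℕ)

/-- The names of the six bases. -/
inductive BasisName
  | Ba | Bb | Bc | Bd | Be | Bf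

/-- Representatives of the `S₃` equivalence classes in each basis. -/
def representatives : BasisName → List Entry :=
  -- knots 600101, dual polynomial c₁⁵
  let qa : Entry := (![6, 0, 0, 1, 0, 1, 0, 0, 0, 0], 1 / 4, ![5, 0, 0, 0, 0, 0, 0, 0, 0, 0])
  -- knots 500201, dual polynomial c₁⁴c₄
  let qb : Entry := (![5, 0, 0, 2, 0, 1, 0, 0, 0, 0], 1 / 4, ![4, 0, 0, 1, 0, 0, 0, 0, 0, 0])
  -- knots 410201, dual polynomial c₁³c₄²
  let qe : Entry := (![4, 1, 0, 2, 0, 1, 0, 0, 0, 0], 1 / 2, ![3, 0, 0, 2, 0, 0, 0, 0, 0, 0])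
  -- knots 320201, dual polynomial c₁²c₂c₄²
  let qf : Entry := (![3, 2, 0, 2, 0, 1, 0, 0, 0, 0], 1 / 2, ![2, 1, 0, 2, 0, 0, 0, 0, 0, 0])
  -- knots 220211, dual polynomial c₁c₂c₄²c₁₀ (basis c)
  let qg : Entry := (![2, 2, 0, 2, 1, 1, 0, 0, 0, 0], 3 / 4, ![1, 1, 0, 2, 0, 0, 0, 0, 0, 1])
  -- knots 220211, dual polynomial c₁c₂c₃c₄² (basis f)
  let qg' : Entry := (![2, 2, 0, 2, 1, 1, 0, 0, 0, 0], 1 / 4, ![1, 1, 1, 2, 0, 0, 0, 0, 0, 0])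
  -- knots 141110, dual polynomial c₂³c₄c₅
  let ql : Entry := (![1, 4, 1, 1, 1, 0, 0, 0, 0, 0], 1, ![0, 3, 0, 1, 1, 0, 0, 0, 0, 0])
  -- knots 222110, dual polynomial c₁c₂²c₃c₁₀
  let qn : Entry := (![2, 2, 2, 1, 1, 0, 0, 0, 0, 0], 3 / 4, ![1, 2, 1, 0, 0, 0, 0, 0, 0, 1])
  -- knots 221111, dual polynomial c₁c₂c₃c₄c₁₀
  let qo : Entry := (![2, 2, 1, 1, 1, 1, 0, 0, 0, 0], 3 / 4, ![1, 1, 1, 1, 0, 0, 0, 0, 0, 1])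
  -- knots 321200, dual polynomial c₁²c₂c₄²
  let qq : Entry := (![3, 2, 1, 2, 0, 0, 0, 0, 0, 0], 1, ![2, 1, 0, 2, 0, 0, 0, 0, 0, 0])
  -- knots 131210, dual polynomial c₁c₂²c₄c₅
  let qr : Entry := (![1, 3, 1, 2, 1, 0, 0, 0, 0, 0], 1 / 2, ![1, 2, 0, 1, 1, 0, 0, 0, 0, 0])
  -- knots 221210, dual polynomial c₁c₂²c₄c₁₀ (bases a, b)
  let qs : Entry := (![2, 2, 1, 2, 1, 0, 0, 0, 0, 0], 3 / 4, ![1, 2, 0, 1, 0, 0, 0, 0, 0, 1])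
  -- knots 221210, dual polynomial c₁c₂²c₃c₄ (bases d, e)
  let qs' : Entry := (![2, 2, 1, 2, 1, 0, 0, 0, 0, 0], 1 / 4, ![1, 2, 1, 1, 0, 0, 0, 0, 0, 0])
  -- knots 121211, dual polynomial c₁c₂c₄c₅c₁₀ (basis c)
  let qt : Entry := (![1, 2, 1, 2, 1, 1, 0, 0, 0, 0], 3 / 4, ![1, 1, 0, 1, 1, 0, 0, 0, 0, 1])
  -- knots 121211, dual polynomial c₁c₂c₃c₄c₈ (basis f)
  let qt' : Entry := (![1, 2, 1, 2, 1, 1, 0, 0, 0, 0], 1 / 2, ![1, 1, 1, 1, 0, 0, 0, 1, 0, 0])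
  fun
  | .Ba => [qa, qb, qe, qf, ql, qn, qr, qs]
  | .Bb => [qa, qb, qe, qf, ql, qo, qr, qs]
  | .Bc => [qa, qb, qe, qf, qg, ql, qr, qt]
  | .Bd => [qa, qb, qe, ql, qn, qq, qr, qs']
  | .Be => [qa, qb, qe, ql, qo, qq, qr, qs']
  | .Bf => [qa, qb, qe, qg', ql, qq, qr, qt']

/-- The 39 members of a basis: the union of the `S₃` equivalence classes of its
representatives. -/
def entries (b : BasisName) : Finset Entry :=
  (Finset.univ ×ˢ (representatives b).toFinset).image
    fun s : Equiv.Perm (Fin 3) × Entry => (permute s.1 s.2.1, s.2.2.1, permute s.1 s.2.2.2)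

/-- The index set of a basis; it has 39 elements. -/
abbrev Index (b : BasisName) := {s : Entry // s ∈ entries b}

/-- The basis function `S = w Q[K]`. -/
noncomputable def basisSpline (b : BasisName) (v : Fin 3 → Plane) (s : Index b) : Plane → ℝ :=
  fun x => (s.1.2.1 : ℝ) * simplexSpline v 5 s.1.1 x

/-- The domain point of a basis function: the average of its five dual points. -/
noncomputable def domainPoint (b : BasisName) (v : Fin 3 → Plane) (s : Index b) : Plane :=
  (1 / 5 : ℝ) • ∑ j, (s.1.2.2 j : ℝ) • vertex v j

/-- The spline `f = Sᵀ c`. -/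
noncomputable def spline (b : BasisName) (v : Fin 3 → Plane) (c : Index b → ℝ) : Plane → ℝ :=
  fun x => ∑ s, c s * basisSpline b v s x

/-- The collocation matrix `M = (Sⱼ(ξᵢ))`. -/
noncomputable def collocation (b : BasisName) (v : Fin 3 → Plane) :
    Matrix (Index b) (Index b) ℝ :=
  Matrix.of fun i j => basisSpline b v j (domainPoint b v i)

/-- `K > 0` is a stability constant of the basis, the same for all triangles:
`K⁻¹ ‖c‖_∞ ≤ ‖f‖_{L_∞} ≤ ‖c‖_∞` for every `f = Sᵀ c` on every nondegenerate triangle. -/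
def IsStabilityConstant (b : BasisName) (K : ℝ) : Prop :=
  0 < K ∧ ∀ v : Fin 3 → Plane, AffineIndependent ℝ v → ∀ c : Index b → ℝ,
    ENNReal.ofReal (K⁻¹ * ‖c‖) ≤ eLpNorm (spline b v c) ⊤ (volume.restrict (triangle v)) ∧
    eLpNorm (spline b v c) ⊤ (volume.restrict (triangle v)) ≤ ENNReal.ofReal ‖c‖

/-- The Hessian matrix at `x` of a function on the macrotriangle (one-sided on the boundary). -/
noncomputable def hessian (v : Fin 3 → Plane) (f : Plane → ℝ) (x : Plane) :
    Matrix (Fin 2) (Fin 2) ℝ :=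
  Matrix.of fun i j => iteratedFDerivWithin ℝ 2 f (triangle v) x
    ![EuclideanSpace.single i 1, EuclideanSpace.single j 1]

/-- The length of the longest edge. -/
noncomputable def longestEdge (v : Fin 3 → Plane) : ℝ :=
  max (max (dist (v 0) (v 1)) (dist (v 1) (v 2))) (dist (v 0) (v 2))

/-! ### Sanity facts for the definitions -/

theorem card_entries (b : BasisName) : (entries b).card = 39 := by
  cases b <;> decide +kernel

theorem vertex_vertexPerm (v : Fin 3 → Plane) (σ : Equiv.Perm (Fin 3)) (j : Fin 10) :
    vertex v (vertexPerm σ j) = vertex (v ∘ σ) j := by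
  have h01 : σ 0 ≠ σ 1 := fun h => absurd (σ.injective h) (by decide)
  have h02 : σ 0 ≠ σ 2 := fun h => absurd (σ.injective h) (by decide)
  have h12 : σ 1 ≠ σ 2 := fun h => absurd (σ.injective h) (by decide)
  simp only [vertex, vertexPerm, Function.comp_apply]
  generalize σ 0 = x at *
  generalize σ 1 = y at *
  generalize σ 2 = z at *
  fin_cases x <;> fin_cases y <;> first | exact absurd rfl h01 | skip
  all_goals fin_cases z <;> first | exact absurd rfl h02 | exact absurd rfl h12 | skip
  all_goals fin_cases j <;> simp <;> abel

theorem knotCoeff_spec (v : Fin 3 → Plane) (m : Fin 10 → ℕ) (h : knotTriple v m ≠ none)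
    (x : Plane) :
    (∑ j, knotCoeff v m x j • vertex v j = x) ∧ ∑ j, knotCoeff v m x j = 1 ∧
      ∀ j, m j = 0 → knotCoeff v m x j = 0 := by
  rcases ht : knotTriple v m with _ | ⟨i, j, k⟩
  · exact absurd ht h
  · have hp := List.find?_some ht
    simp only [decide_eq_true_eq] at hp
    obtain ⟨hi, hj, hk, ho⟩ := hp
    simp only [knotCoeff, ht]
    refine ⟨?_, ?_, ?_⟩
    · simp only [Pi.add_apply, add_smul, Finset.sum_add_distrib, Pi.single_apply, ite_smul,
        zero_smul, Finset.sum_ite_eq', Finset.mem_univ, if_true]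
      generalize vertex v i = p at *
      generalize vertex v j = q at *
      generalize vertex v k = r at *
      ext l
      simp only [PiLp.add_apply, PiLp.smul_apply, smul_eq_mul]
      field_simp
      fin_cases l <;> simp [orient] <;> ring
    · simp only [Pi.add_apply, Finset.sum_add_distrib, Finset.sum_pi_single', Finset.mem_univ,
        if_true]
      generalize vertex v i = p at *
      generalize vertex v j = q at *
      generalize vertex v k = r at *
      field_simp
      simp only [orient]
      ring
    · intro l hl
      have h1 : l ≠ i := fun h => hi (h ▸ hl)
      have h2 : l ≠ j := fun h => hj (h ▸ hl)
      have h3 : l ≠ k := fun h => hk (h ▸ hl)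
      simp [h1, h2, h3]

end PS12

/-!
On each face a simplex spline is a polynomial, given by the recurrence itself. This polynomial does
not depend on the coefficients `β` chosen in the recurrence: in degree zero because signed triangles
are additive, in higher degrees by eliminating a knot with an affine dependency. Hence at every step
the coefficients may be taken supported on three knots. Taking two of them on a line of the split
shows by induction that the pieces on the two sides of that line differ by a power of its equation,
with one factor less for each knot on the line; for the knots of the six bases at least the fourth
power remains, so the splines are `C³`.

In the barycentric coordinates of a face, the values of the basis functions and the domain points
are given by integers that are the same for all triangles. The local polynomials have nonnegative
coefficients, so the basis functions are nonnegative. That the coordinates of the domain points are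
the coefficients of the coordinate functions is an identity between polynomials with natural number
coefficients, so it suffices to compare values at one large point (Kronecker substitution). This
identity contains the partition of unity. A multiple of the collocation matrix by positive row
factors has integer entries, and it is nonsingular since it is nonsingular modulo `17`.

Nonnegativity and the partition of unity give `‖f‖ ≤ ‖c‖`, and interpolation at the domain points
gives `‖c‖ ≤ ‖M⁻¹‖ ‖f‖`. For the Hessian estimate, subtract from `f` its tangent plane at a domain
point `ξ`. The plane is a spline whose coefficients are its own values at the domain points, so the
coefficient of `f - plane` at `ξ` is `c - f ξ`, and stability bounds it by `K` times the Taylor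
remainder.
-/

namespace PS12

/-! ### Barycentric coordinates in the plane -/

/-- Twice the signed area of the triangle with corners `p 0`, `p 1`, `p 2`. -/
def signedArea (p : Fin 3 → Plane) : ℝ := orient (p 0) (p 1) (p 2)

/-- The barycentric coordinates of a point with respect to three points, by Cramer's rule; they
are `0` if the three points are collinear. -/
noncomputable def bary (p : Fin 3 → Plane) (x : Plane) (i : Fin 3) : ℝ :=
  signedArea (Function.update p i x) / signedArea p

theorem signedArea_update_zero (p : Fin 3 → Plane) (x : Plane) :
    signedArea (Function.update p 0 x) = orient x (p 1) (p 2) := rfl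

theorem signedArea_update_one (p : Fin 3 → Plane) (x : Plane) :
    signedArea (Function.update p 1 x) = orient (p 0) x (p 2) := rfl

theorem signedArea_update_two (p : Fin 3 → Plane) (x : Plane) :
    signedArea (Function.update p 2 x) = orient (p 0) (p 1) x := rfl

theorem signedArea_ne_zero {v : Fin 3 → Plane} (hv : AffineIndependent ℝ v) :
    signedArea v ≠ 0 := by
  intro h
  have edge_eq (l : Fin 2) : v 2 l - v 0 l = 0 := by
    have hw := affineIndependent_iff.1 hv Finset.univ
      ![(v 1 l - v 0 l) - (v 2 l - v 0 l), v 2 l - v 0 l, -(v 1 l - v 0 l)]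
      (by simp [Fin.sum_univ_three])
      (by
        simp only [signedArea, orient] at h
        ext i
        simp only [Fin.sum_univ_three, Matrix.cons_val, PiLp.add_apply, PiLp.smul_apply,
          smul_eq_mul, PiLp.zero_apply]
        fin_cases l <;> fin_cases i <;> simp only [Fin.zero_eta, Fin.mk_one] <;>
          first | ring1 | linear_combination h | linear_combination -h)
    exact hw 1 (Finset.mem_univ 1)
  have h20 : v 2 = v 0 := by
    ext l
    exact sub_eq_zero.1 (edge_eq l)
  exact absurd (hv.injective h20) (by decide)

section

variable {p : Fin 3 → Plane} (hp : signedArea p ≠ 0)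

include hp

theorem sum_bary (x : Plane) : ∑ i, bary p x i = 1 := by
  simp only [Fin.sum_univ_three, bary, ← add_div, signedArea_update_zero, signedArea_update_one,
    signedArea_update_two]
  rw [div_eq_one_iff_eq hp]
  simp only [signedArea, orient]
  ring

theorem sum_bary_smul (x : Plane) : ∑ i, bary p x i • p i = x := by
  ext l
  simp only [Fin.sum_univ_three, bary, signedArea_update_zero, signedArea_update_one,
    signedArea_update_two, PiLp.add_apply, PiLp.smul_apply, smul_eq_mul]
  field_simp
  fin_cases l <;> simp only [signedArea, orient, Fin.zero_eta, Fin.mk_one] <;> ring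

theorem bary_sum_smul {w : Fin 3 → ℝ} (hw : ∑ i, w i = 1) : bary p (∑ i, w i • p i) = w := by
  simp only [Fin.sum_univ_three] at hw
  have hw2 : w 2 = 1 - w 0 - w 1 := by linarith
  funext i
  rw [bary, div_eq_iff hp]
  fin_cases i <;>
    simp only [Fin.zero_eta, Fin.mk_one, Fin.reduceFinMk, signedArea_update_zero,
      signedArea_update_one, signedArea_update_two] <;>
    simp only [signedArea, orient, Fin.sum_univ_three, hw2, PiLp.add_apply, PiLp.smul_apply,
      smul_eq_mul] <;>
    ring

theorem bary_corner (j i : Fin 3) : bary p (p j) i = if j = i then 1 else 0 := by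
  have h := congrFun (bary_sum_smul hp (w := Pi.single j 1) (by simp)) i
  simpa [Pi.single_apply, ite_smul, eq_comm] using h

theorem bary_affineCombination {ι : Type*} [Fintype ι] {w : ι → ℝ} (hw : ∑ j, w j = 1)
    (q : ι → Plane) (i : Fin 3) : bary p (∑ j, w j • q j) i = ∑ j, w j * bary p (q j) i := by
  have hsum : ∑ i, ∑ j, w j * bary p (q j) i = 1 := by
    rw [Finset.sum_comm]
    simp only [← Finset.mul_sum, sum_bary hp, mul_one, hw]
  rw [← congrFun (bary_sum_smul hp hsum) i]
  congr 1
  simp only [Finset.sum_smul, mul_smul]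
  rw [Finset.sum_comm]
  simp only [← Finset.smul_sum, sum_bary_smul hp]

theorem mem_convexHull_range_iff {x : Plane} :
    x ∈ convexHull ℝ (Set.range p) ↔ ∀ i, 0 ≤ bary p x i := by
  constructor
  · intro hx
    rw [mem_convexHull_iff_exists_fintype] at hx
    obtain ⟨ι, _, w, z, hw0, hw1, hz, rfl⟩ := hx
    choose s hs using hz
    intro i
    rw [bary_affineCombination hp hw1]
    refine Finset.sum_nonneg fun j _ => mul_nonneg (hw0 j) ?_
    rw [← hs j, bary_corner hp]
    split_ifs <;> simp
  · intro h
    rw [← sum_bary_smul hp x]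
    exact (convex_convexHull ℝ _).sum_mem (fun i _ => h i) (sum_bary hp x)
      fun i _ => subset_convexHull ℝ _ ⟨i, rfl⟩

end

theorem signedArea_sum_smul (p : Fin 3 → Plane) {a : Fin 3 → Fin 3 → ℝ}
    (ha : ∀ i, ∑ j, a i j = 1) :
    signedArea (fun i => ∑ j, a i j • p j) = Matrix.det (Matrix.of a) * signedArea p := by
  simp only [Fin.sum_univ_three] at ha
  have ha2 (i : Fin 3) : a i 2 = 1 - a i 0 - a i 1 := by linarith [ha i]
  simp only [signedArea, orient, Fin.sum_univ_three, Matrix.det_fin_three, Matrix.of_apply, ha2,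
    PiLp.add_apply, PiLp.smul_apply, smul_eq_mul]
  ring

theorem measure_convexHull_lt_top {s : Set Plane} (hs : s.Finite) :
    volume (convexHull ℝ s) < ⊤ :=
  (hs.isCompact_convexHull ℝ).measure_lt_top

/-- The linear part of the affine map that takes the standard triangle to the triangle `p`. -/
noncomputable def edgeMap (p : Fin 3 → Plane) : Plane →ₗ[ℝ] Plane :=
  Matrix.toLin (EuclideanSpace.basisFun (Fin 2) ℝ).toBasis
    (EuclideanSpace.basisFun (Fin 2) ℝ).toBasis (Matrix.of fun l i => p i.succ l - p 0 l)

theorem det_edgeMap (p : Fin 3 → Plane) : LinearMap.det (edgeMap p) = signedArea p := by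
  rw [edgeMap, LinearMap.det_toLin, Matrix.det_fin_two, signedArea, orient]
  simp only [Matrix.of_apply, Fin.succ_zero_eq_one, Fin.succ_one_eq_two]
  ring

theorem edgeMap_single (p : Fin 3 → Plane) (i : Fin 2) :
    edgeMap p (EuclideanSpace.single i 1) = p i.succ - p 0 := by
  have h := Matrix.toLin_self (EuclideanSpace.basisFun (Fin 2) ℝ).toBasis
    (EuclideanSpace.basisFun (Fin 2) ℝ).toBasis (Matrix.of fun l i => p i.succ l - p 0 l) i
  simp only [OrthonormalBasis.coe_toBasis, EuclideanSpace.basisFun_apply, Fin.sum_univ_two] at h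
  rw [edgeMap, h]
  ext l
  fin_cases l <;> simp

/-- The corners `(0, 0)`, `(1, 0)`, `(0, 1)` of the standard triangle. -/
noncomputable def standardCorner : Fin 3 → Plane :=
  ![0, EuclideanSpace.single 0 1, EuclideanSpace.single 1 1]

theorem convexHull_range_eq_image (p : Fin 3 → Plane) :
    convexHull ℝ (Set.range p) =
      (p 0 + ·) '' (edgeMap p '' convexHull ℝ (Set.range standardCorner)) := by
  have hp : p = (p 0 + ·) ∘ edgeMap p ∘ standardCorner := by
    funext i
    fin_cases i <;> simp [standardCorner, edgeMap_single]
  conv_lhs => rw [hp, Set.range_comp, Set.range_comp]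
  rw [(edgeMap p).image_convexHull]
  exact ((AffineEquiv.constVAdd ℝ Plane (p 0)).toAffineMap.image_convexHull _).symm

theorem area_convexHull_range (p : Fin 3 → Plane) :
    area (convexHull ℝ (Set.range p)) =
      |signedArea p| * area (convexHull ℝ (Set.range standardCorner)) := by
  rw [area, convexHull_range_eq_image, Set.image_add_left, measure_preimage_add,
    Measure.addHaar_image_linearMap, det_edgeMap, ENNReal.toReal_mul,
    ENNReal.toReal_ofReal (abs_nonneg _), area]

theorem area_standardTriangle_pos : 0 < area (convexHull ℝ (Set.range standardCorner)) := by
  refine ENNReal.toReal_pos (ne_of_gt ?_) (measure_convexHull_lt_top (Set.finite_range _)).ne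
  have hsub : {y : Plane | 0 < y 0 ∧ 0 < y 1 ∧ y 0 + y 1 < 1} ⊆
      convexHull ℝ (Set.range standardCorner) := by
    rintro y ⟨h0, h1, h2⟩
    have hy : y = ∑ i, ![1 - y 0 - y 1, y 0, y 1] i • standardCorner i := by
      ext l
      fin_cases l <;> simp [Fin.sum_univ_three, standardCorner]
    rw [hy]
    refine (convex_convexHull ℝ _).sum_mem (fun i _ => ?_) ?_
      fun i _ => subset_convexHull ℝ _ ⟨i, rfl⟩
    · fin_cases i <;> simp <;> linarith
    · simp only [Fin.sum_univ_three, Matrix.cons_val]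
      ring
  have hopen : IsOpen {y : Plane | 0 < y 0 ∧ 0 < y 1 ∧ y 0 + y 1 < 1} := by
    have h0 : Continuous fun y : Plane => y 0 := by fun_prop
    have h1 : Continuous fun y : Plane => y 1 := by fun_prop
    exact (isOpen_lt continuous_const h0).inter
      ((isOpen_lt continuous_const h1).inter (isOpen_lt (h0.add h1) continuous_const))
  refine lt_of_lt_of_le (hopen.measure_pos volume ⟨!₂[1 / 4, 1 / 4], ?_⟩) (measure_mono hsub)
  refine ⟨?_, ?_, ?_⟩ <;> norm_num

/-! ### The vertices of the split in barycentric coordinates -/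

/-- Twelve times the barycentric coordinates of the vertices of the split. -/
def vertexCoord : Fin 10 → Fin 3 → ℤ :=
  ![![12, 0, 0], ![0, 12, 0], ![0, 0, 12], ![6, 6, 0], ![0, 6, 6], ![6, 0, 6],
    ![6, 3, 3], ![3, 6, 3], ![3, 3, 6], ![4, 4, 4]]

theorem sum_vertexCoord (j : Fin 10) : ∑ i, vertexCoord j i = 12 := by
  revert j
  decide

theorem vertex_eq_sum (v : Fin 3 → Plane) (j : Fin 10) :
    vertex v j = ∑ i, ((vertexCoord j i : ℝ) / 12) • v i := by
  rw [Fin.sum_univ_three]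
  fin_cases j <;> simp [vertex, vertexCoord] <;> module

/-- The determinant of the scaled barycentric coordinates of three vertices, written out so that
it evaluates fast. -/
def labelDet (t : Fin 3 → Fin 10) : ℤ :=
  let a := vertexCoord (t 0)
  let b := vertexCoord (t 1)
  let c := vertexCoord (t 2)
  a 0 * b 1 * c 2 - a 0 * b 2 * c 1 - a 1 * b 0 * c 2 + a 1 * b 2 * c 0 + a 2 * b 0 * c 1 -
    a 2 * b 1 * c 0

theorem signedArea_vertex (v : Fin 3 → Plane) (t : Fin 3 → Fin 10) :
    signedArea (vertex v ∘ t) = labelDet t / 1728 * signedArea v := by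
  have hsum (i : Fin 3) : ∑ j, (vertexCoord (t i) j : ℝ) / 12 = 1 := by
    rw [← Finset.sum_div, ← Int.cast_sum, sum_vertexCoord]
    norm_num
  have h := signedArea_sum_smul v hsum
  simp only [← vertex_eq_sum] at h
  rw [Function.comp_def, h, Matrix.det_fin_three, labelDet]
  push_cast [Matrix.of_apply]
  ring

section

variable {v : Fin 3 → Plane} (hv : signedArea v ≠ 0)

include hv

theorem signedArea_vertex_ne_zero_iff {t : Fin 3 → Fin 10} :
    signedArea (vertex v ∘ t) ≠ 0 ↔ labelDet t ≠ 0 := by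
  simp [signedArea_vertex, hv]

theorem bary_vertex (t : Fin 3 → Fin 10) (j : Fin 10) (i : Fin 3) :
    bary (vertex v ∘ t) (vertex v j) i = labelDet (Function.update t i j) / labelDet t := by
  rw [bary, ← Function.comp_update, signedArea_vertex, signedArea_vertex]
  rw [mul_div_mul_right _ _ hv, div_div_div_cancel_right₀ (by norm_num)]

theorem area_ratio (t : Fin 3 → Fin 10) :
    area (triangle v) / area (convexHull ℝ (Set.range (vertex v ∘ t))) = 1728 / |labelDet t| := by
  rw [triangle, area_convexHull_range v, area_convexHull_range (vertex v ∘ t), signedArea_vertex,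
    mul_div_mul_right _ _ area_standardTriangle_pos.ne', abs_mul,
    div_mul_cancel_right₀ (abs_ne_zero.2 hv), abs_div, inv_div, Int.cast_abs]
  norm_num

end

/-! ### The faces of the split -/

/-- The corners of a face, in increasing order of their labels. -/
def faceCorner : Fin 12 → Fin 3 → Fin 10 :=
  ![![0, 5, 6], ![0, 3, 6], ![1, 3, 7], ![1, 4, 7], ![2, 4, 8], ![2, 5, 8],
    ![5, 6, 9], ![3, 6, 9], ![3, 7, 9], ![4, 7, 9], ![4, 8, 9], ![5, 8, 9]]

theorem faceVertices_eq (k : Fin 12) : faceVertices k = Finset.univ.image (faceCorner k) := by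
  revert k
  decide

theorem labelDet_faceCorner_ne_zero (k : Fin 12) : labelDet (faceCorner k) ≠ 0 := by
  revert k
  decide +kernel

theorem face_eq (v : Fin 3 → Plane) (k : Fin 12) :
    face v k = convexHull ℝ (Set.range (vertex v ∘ faceCorner k)) := by
  rw [face, Set.range_comp, faceVertices_eq, Finset.coe_image, Finset.coe_univ, Set.image_univ]

theorem isClosed_face (v : Fin 3 → Plane) (k : Fin 12) : IsClosed (face v k) := by
  rw [face_eq]
  exact ((Set.finite_range _).isCompact_convexHull ℝ).isClosed

theorem vertex_mem_triangle (v : Fin 3 → Plane) (j : Fin 10) : vertex v j ∈ triangle v := by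
  rw [vertex_eq_sum, triangle]
  refine (convex_convexHull ℝ _).sum_mem (fun i _ => ?_) ?_ fun i _ =>
    subset_convexHull ℝ _ (Set.mem_range_self i)
  · have : ∀ j i, 0 ≤ vertexCoord j i := by decide
    have := this j i
    positivity
  · have := sum_vertexCoord j
    rw [← Finset.sum_div, ← Int.cast_sum, this]
    norm_num

theorem face_subset_triangle (v : Fin 3 → Plane) (k : Fin 12) : face v k ⊆ triangle v := by
  rw [face_eq]
  exact convexHull_min (Set.range_subset_iff.2 fun i => vertex_mem_triangle v _)
    (convex_convexHull ℝ _)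

theorem exists_mem_face_of_coords (v : Fin 3 → Plane) (σ : Equiv.Perm (Fin 3)) (k : Fin 12)
    {x : Plane} (c : Fin 10 → ℝ) (hc : ∀ j ∈ faceVertices k, 0 ≤ c j)
    (hc1 : ∑ j ∈ faceVertices k, c j = 1)
    (hcx : ∑ j ∈ faceVertices k, c j • vertex (v ∘ σ) j = x) : ∃ l, x ∈ face v l := by
  obtain ⟨l, hl⟩ : ∃ l, (faceVertices k).image (vertexPerm σ) = faceVertices l := by
    exact (by decide +kernel : ∀ (σ : Equiv.Perm (Fin 3)) (k : Fin 12),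
      ∃ l, (faceVertices k).image (vertexPerm σ) = faceVertices l) σ k
  refine ⟨l, ?_⟩
  rw [← hcx, face, ← hl]
  refine (convex_convexHull ℝ _).sum_mem hc hc1 fun j hj => subset_convexHull ℝ _ ?_
  exact ⟨_, by simpa using ⟨j, hj, rfl⟩, vertex_vertexPerm v σ j⟩

theorem exists_mem_face {v : Fin 3 → Plane} (hv : signedArea v ≠ 0) {x : Plane}
    (hx : x ∈ triangle v) : ∃ k, x ∈ face v k := by
  obtain ⟨w, hw0, hw1, hwx⟩ : ∃ w : Fin 3 → ℝ, (∀ i, 0 ≤ w i) ∧ ∑ i, w i = 1 ∧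
      ∑ i, w i • v i = x :=
    ⟨bary v x, (mem_convexHull_range_iff hv).1 hx, sum_bary hv x, sum_bary_smul hv x⟩
  -- Sort the barycentric coordinates decreasingly; the symmetry leaves two faces to consider.
  obtain ⟨σ, h01, h12⟩ : ∃ σ : Equiv.Perm (Fin 3), w (σ 1) ≤ w (σ 0) ∧ w (σ 2) ≤ w (σ 1) := by
    have h := Tuple.monotone_sort fun i => -w i
    exact ⟨_, neg_le_neg_iff.1 (h (Fin.zero_le 1)), neg_le_neg_iff.1 (h (by decide : 1 ≤ 2))⟩
  have hx : x = w (σ 0) • v (σ 0) + w (σ 1) • v (σ 1) + w (σ 2) • v (σ 2) := by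
    rw [← hwx, ← Equiv.sum_comp σ, Fin.sum_univ_three]
  rw [← Equiv.sum_comp σ, Fin.sum_univ_three] at hw1
  rcases le_total (w (σ 1) + w (σ 2)) (w (σ 0)) with h | h
  · refine exists_mem_face_of_coords v σ 1 ![w (σ 0) - w (σ 1) - w (σ 2), 0, 0,
      2 * (w (σ 1) - w (σ 2)), 0, 0, 4 * w (σ 2), 0, 0, 0] ?_ ?_ ?_
    · simp [faceVertices, hw0, h12]; linarith
    · simp [faceVertices]; linarith
    · simp [faceVertices, vertex, hx]; module
  · refine exists_mem_face_of_coords v σ 7 ![0, 0, 0, 2 * (w (σ 1) - w (σ 2)), 0, 0,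
      4 * (w (σ 0) - w (σ 1)), 0, 0, 3 * (w (σ 1) + w (σ 2) - w (σ 0))] ?_ ?_ ?_
    · simp [faceVertices, h, h01, h12]
    · simp [faceVertices]; linarith
    · simp [faceVertices, vertex, hx]; module

theorem iUnion_face {v : Fin 3 → Plane} (hv : signedArea v ≠ 0) :
    ⋃ k, face v k = triangle v :=
  (Set.iUnion_subset (face_subset_triangle v)).antisymm fun _ hx =>
    Set.mem_iUnion.2 (exists_mem_face hv hx)

theorem exists_mem_halfOpenFace {v : Fin 3 → Plane} (hv : signedArea v ≠ 0) {x : Plane}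
    (hx : x ∈ triangle v) : ∃ k, x ∈ halfOpenFace v k := by
  obtain ⟨k, hk, hmin⟩ := WellFounded.has_min (wellFounded_lt (α := Fin 12)) {k | x ∈ face v k}
    (exists_mem_face hv hx)
  exact ⟨k, hk, fun l hl hxl => hmin l hxl hl⟩

theorem halfOpenFace_unique {v : Fin 3 → Plane} {x : Plane} {k l : Fin 12}
    (hk : x ∈ halfOpenFace v k) (hl : x ∈ halfOpenFace v l) : k = l :=
  le_antisymm (not_lt.1 fun h => hk.2 l h hl.1) (not_lt.1 fun h => hl.2 k h hk.1)

theorem mem_halfOpenHull_iff {v : Fin 3 → Plane} {m : Fin 10 → ℕ} {x : Plane} {k : Fin 12}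
    (hk : x ∈ halfOpenFace v k) : x ∈ halfOpenHull v m ↔ face v k ⊆ hull v m := by
  simp only [halfOpenHull, Set.mem_iUnion, Set.mem_ofPred_eq, exists_prop]
  constructor
  · rintro ⟨l, hl, hxl⟩
    rwa [halfOpenFace_unique hk hxl]
  · exact fun h => ⟨k, h, hk⟩

/-- The face `k` lies in the nondegenerate triangle with the vertices `t`. -/
def Covers (k : Fin 12) (t : Fin 3 → Fin 10) : Prop :=
  labelDet t ≠ 0 ∧ ∀ l i, 0 ≤ labelDet (Function.update t i (faceCorner k l)) * labelDet t

instance (k : Fin 12) (t : Fin 3 → Fin 10) : Decidable (Covers k t) :=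
  inferInstanceAs (Decidable (_ ∧ _))

theorem face_subset_convexHull_iff {v : Fin 3 → Plane} (hv : signedArea v ≠ 0) {k : Fin 12}
    {t : Fin 3 → Fin 10} (ht : labelDet t ≠ 0) :
    face v k ⊆ convexHull ℝ (Set.range (vertex v ∘ t)) ↔ Covers k t := by
  rw [face_eq, (convex_convexHull ℝ _).convexHull_subset_iff, Set.range_subset_iff, Covers]
  simp only [mem_convexHull_range_iff ((signedArea_vertex_ne_zero_iff hv).2 ht),
    Function.comp_apply, bary_vertex hv, ht, ne_eq, not_false_eq_true, true_and]
  refine forall₂_congr fun l i => ?_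
  have ht' : (labelDet t : ℝ) ≠ 0 := Int.cast_ne_zero.2 ht
  rw [← mul_div_mul_right _ _ ht', le_div_iff₀ (mul_self_pos.2 ht'), zero_mul]
  exact_mod_cast Iff.rfl



/-! ### The polynomial pieces of simplex splines -/

open Classical in
/-- The value at `x` of the polynomial that the simplex spline of degree `d` with knot multiset
`m` equals on the half-open face `k`. In degree `0` a vanishing area gives the value `0`. -/
noncomputable def facePiece (v : Fin 3 → Plane) (k : Fin 12) : ℕ → (Fin 10 → ℕ) → Plane → ℝ
  | 0, m, _ => if face v k ⊆ hull v m then area (triangle v) / area (hull v m) else 0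
  | d + 1, m, x => ∑ j, knotCoeff v m x j * facePiece v k d (m - Pi.single j 1) x

theorem sum_single_ne_zero_iff {n : ℕ} (t : Fin n → Fin 10) {j : Fin 10} :
    (∑ i, Pi.single (t i) 1 : Fin 10 → ℕ) j ≠ 0 ↔ j ∈ Set.range t := by
  simp [Finset.sum_apply, Pi.single_apply, eq_comm (a := j)]

theorem single_le_of_ne_zero {m : Fin 10 → ℕ} {j : Fin 10} (hj : m j ≠ 0) : Pi.single j 1 ≤ m :=
  update_le_iff.2 ⟨Nat.one_le_iff_ne_zero.2 hj, fun i _ => Nat.zero_le (m i)⟩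

theorem sum_tsub_single {n : ℕ} {m : Fin 10 → ℕ} (hm : ∑ j, m j = n + 1) {j : Fin 10}
    (hj : m j ≠ 0) : ∑ i, (m - Pi.single j 1 : Fin 10 → ℕ) i = n := by
  rw [← Nat.add_right_cancel_iff (n := 1), ← hm]
  conv_rhs => rw [← tsub_add_cancel_of_le (single_le_of_ne_zero hj)]
  simp [Finset.sum_add_distrib]

theorem hull_sum_single (v : Fin 3 → Plane) {n : ℕ} (t : Fin n → Fin 10) :
    hull v (∑ i, Pi.single (t i) 1) = convexHull ℝ (Set.range (vertex v ∘ t)) := by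
  rw [hull, Set.range_comp]
  congr 2
  exact Set.ext fun j => sum_single_ne_zero_iff t

theorem exists_monotone_eq_sum_single {n : ℕ} {m : Fin 10 → ℕ} (hm : ∑ j, m j = n) :
    ∃ q : Fin n → Fin 10, Monotone q ∧ m = ∑ i, Pi.single (q i) 1 := by
  induction n generalizing m with
  | zero =>
    refine ⟨Fin.elim0, fun i => i.elim0, ?_⟩
    simpa [funext_iff] using hm
  | succ n ih =>
    obtain ⟨j, hj, hmin⟩ := WellFounded.has_min (wellFounded_lt (α := Fin 10)) {j | m j ≠ 0} (by
      by_contra! h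
      have hm0 : m = 0 := funext fun j => not_not.1 (Set.eq_empty_iff_forall_notMem.1 h j)
      simp [hm0] at hm)
    obtain ⟨q, hq, hmq⟩ := ih (sum_tsub_single hm hj)
    have hm_eq : m = Pi.single j 1 + ∑ i, Pi.single (q i) 1 := by
      rw [← hmq, add_tsub_cancel_of_le (single_le_of_ne_zero hj)]
    refine ⟨Fin.cons j q, fun a b hab => ?_, by simpa [Fin.sum_univ_succ] using hm_eq⟩
    have j_le (b : Fin n) : j ≤ q b := by
      refine not_lt.1 (hmin (q b) fun h0 => ?_)
      have h := (sum_single_ne_zero_iff q).2 ⟨b, rfl⟩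
      rw [hm_eq] at h0
      simp_all
    cases a using Fin.cases <;> cases b using Fin.cases
    · exact le_rfl
    · simpa using j_le _
    · simp at hab
    · simpa using hq (Fin.succ_le_succ_iff.1 hab)

theorem knotTriple_spec {v : Fin 3 → Plane} {m : Fin 10 → ℕ} {t : Fin 10 × Fin 10 × Fin 10}
    (h : knotTriple v m = some t) : m t.1 ≠ 0 ∧ m t.2.1 ≠ 0 ∧ m t.2.2 ≠ 0 ∧
      orient (vertex v t.1) (vertex v t.2.1) (vertex v t.2.2) ≠ 0 := by
  simpa using List.find?_some h

theorem mem_triples {i j k : Fin 10} : (i, j, k) ∈ triples ↔ i < j ∧ j < k := by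
  simp [triples]

theorem orient_eq_zero_of_knotTriple {v : Fin 3 → Plane} {m : Fin 10 → ℕ}
    (h : knotTriple v m = none) {i j k : Fin 10} (hi : m i ≠ 0) (hj : m j ≠ 0) (hk : m k ≠ 0)
    (hij : i < j) (hjk : j < k) : orient (vertex v i) (vertex v j) (vertex v k) = 0 := by
  have h := List.find?_eq_none.1 h (i, j, k) (mem_triples.2 ⟨hij, hjk⟩)
  simp only [decide_eq_true_eq, not_and, not_not] at h
  exact h hi hj hk

theorem knotTriple_eq_none_of_le {v : Fin 3 → Plane} {m m' : Fin 10 → ℕ} (hle : m' ≤ m)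
    (h : knotTriple v m = none) : knotTriple v m' = none := by
  rw [knotTriple, List.find?_eq_none] at h ⊢
  intro t ht
  have := h t ht
  have pos (j : Fin 10) (hj : m' j ≠ 0) : m j ≠ 0 := fun h0 => hj (Nat.le_zero.1 (h0 ▸ hle j))
  simp only [decide_eq_true_eq] at this ⊢
  exact fun ⟨h1, h2, h3, h4⟩ => this ⟨pos _ h1, pos _ h2, pos _ h3, h4⟩

theorem knotCoeff_eq_zero {v : Fin 3 → Plane} {m : Fin 10 → ℕ} (h : knotTriple v m = none)
    (x : Plane) : knotCoeff v m x = 0 := by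
  rw [knotCoeff, h]

theorem knotTriple_eq_none_of_area {v : Fin 3 → Plane} {m : Fin 10 → ℕ}
    (h : area (hull v m) = 0) : knotTriple v m = none := by
  by_contra hne
  obtain ⟨t, ht⟩ := Option.ne_none_iff_exists'.1 hne
  obtain ⟨h1, h2, h3, h4⟩ := knotTriple_spec ht
  have hsub : convexHull ℝ (Set.range (vertex v ∘ ![t.1, t.2.1, t.2.2])) ⊆ hull v m := by
    rw [Set.range_comp]
    refine convexHull_mono (Set.image_mono ?_)
    rintro _ ⟨i, rfl⟩
    fin_cases i <;> simpa
  have hle : area (convexHull ℝ (Set.range (vertex v ∘ ![t.1, t.2.1, t.2.2]))) ≤ area (hull v m) :=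
    ENNReal.toReal_mono (measure_convexHull_lt_top (Set.toFinite _)).ne (measure_mono hsub)
  rw [h, area_convexHull_range] at hle
  exact hle.not_gt (mul_pos (abs_pos.2 h4) area_standardTriangle_pos)

section

variable {v : Fin 3 → Plane} {k : Fin 12}

theorem facePiece_zero_sum_single (hv : signedArea v ≠ 0) (t : Fin 3 → Fin 10) (x : Plane) :
    facePiece v k 0 (∑ i, Pi.single (t i) 1) x =
      if Covers k t then 1728 / |(labelDet t : ℝ)| else 0 := by
  classical
  rw [facePiece, hull_sum_single]
  by_cases ht : labelDet t = 0
  · rw [area_convexHull_range (vertex v ∘ t), signedArea_vertex]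
    simp [Covers, ht]
  · rw [area_ratio hv, Int.cast_abs, if_congr (face_subset_convexHull_iff hv ht) rfl rfl]

theorem facePiece_eq_zero_of_knotTriple {d : ℕ} {m : Fin 10 → ℕ} (hm : ∑ j, m j = d + 3)
    (h : knotTriple v m = none) (x : Plane) : facePiece v k d m x = 0 := by
  cases d with
  | zero =>
    obtain ⟨t, ht, rfl⟩ := exists_monotone_eq_sum_single hm
    have hdet : signedArea (vertex v ∘ t) = 0 := by
      have pos (i : Fin 3) := (sum_single_ne_zero_iff t).2 ⟨i, rfl⟩
      rcases (ht (by decide : (0 : Fin 3) ≤ 1)).eq_or_lt with h01 | h01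
      · simp [signedArea, orient, h01]
      rcases (ht (by decide : (1 : Fin 3) ≤ 2)).eq_or_lt with h12 | h12
      · simp [signedArea, orient, h12]
        ring
      · exact orient_eq_zero_of_knotTriple h (pos 0) (pos 1) (pos 2) h01 h12
    rw [facePiece, hull_sum_single, area_convexHull_range, hdet]
    simp
  | succ d => simp [facePiece, knotCoeff_eq_zero h]

theorem simplexSpline_eq_facePiece {x : Plane} (hx : x ∈ halfOpenFace v k) (d : ℕ)
    (m : Fin 10 → ℕ) : simplexSpline v d m x = facePiece v k d m x := by
  classical
  induction d generalizing m with
  | zero =>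
    rw [simplexSpline, facePiece, Set.indicator_apply, mem_halfOpenHull_iff hx]
    split_ifs with h <;> simp [h]
  | succ d ih =>
    rw [simplexSpline, facePiece]
    split_ifs with h
    · simp [knotCoeff_eq_zero (knotTriple_eq_none_of_area h)]
    · simp only [ih]

end

/-! ### Independence of the choice of the coefficients -/

/-- Signed triangles are additive: on each face, the triangle `a b c` is the signed sum of the
triangles in which one vertex is replaced by `p`. This fails for the labels `6, …, 9`, whose points
are not joined by lines of the split. -/
theorem sign_covers_eq_sum : ∀ k, ∀ c < 6, ∀ b < c, ∀ a < b, ∀ p < 6,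
    labelDet ![a, b, c] ≠ 0 →
      (labelDet ![a, b, c]).sign * (if Covers k ![a, b, c] then 1 else 0) =
        ∑ l, (labelDet (Function.update ![a, b, c] l p)).sign *
          (if Covers k (Function.update ![a, b, c] l p) then 1 else 0) := by
  decide +kernel

/-- The coefficients `β` represent the point `x` as an affine combination of the knots `m`. -/
structure IsAffineRepr (v : Fin 3 → Plane) (m : Fin 10 → ℕ) (x : Plane) (β : Fin 10 → ℝ) :
    Prop where
  support : ∀ j, m j = 0 → β j = 0
  sum : ∑ j, β j = 1
  sum_smul : ∑ j, β j • vertex v j = x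

/-- The coefficients `α` of an affine dependency between the knots `m`. -/
structure IsAffineDep (v : Fin 3 → Plane) (m : Fin 10 → ℕ) (α : Fin 10 → ℝ) : Prop where
  support : ∀ j, m j = 0 → α j = 0
  sum : ∑ j, α j = 0
  sum_smul : ∑ j, α j • vertex v j = 0

theorem IsAffineRepr.sub {v : Fin 3 → Plane} {m : Fin 10 → ℕ} {x : Plane} {β γ : Fin 10 → ℝ}
    (hβ : IsAffineRepr v m x β) (hγ : IsAffineRepr v m x γ) : IsAffineDep v m (β - γ) where
  support j hj := by simp [hβ.support j hj, hγ.support j hj]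
  sum := by simp [hβ.sum, hγ.sum]
  sum_smul := by simp [sub_smul, hβ.sum_smul, hγ.sum_smul]

theorem IsAffineRepr.sub_smul {v : Fin 3 → Plane} {m : Fin 10 → ℕ} {x : Plane} {β α : Fin 10 → ℝ}
    (hβ : IsAffineRepr v m x β) (hα : IsAffineDep v m α) (c : ℝ) :
    IsAffineRepr v m x (β - c • α) where
  support j hj := by simp [hβ.support j hj, hα.support j hj]
  sum := by simp [hβ.sum, ← Finset.mul_sum, hα.sum]
  sum_smul := by
    simp [_root_.sub_smul, hβ.sum_smul, mul_smul, ← Finset.smul_sum, hα.sum_smul]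

theorem IsAffineDep.sub_smul {v : Fin 3 → Plane} {m : Fin 10 → ℕ} {α β : Fin 10 → ℝ}
    (hα : IsAffineDep v m α) (hβ : IsAffineDep v m β) (c : ℝ) : IsAffineDep v m (α - c • β) where
  support j hj := by simp [hα.support j hj, hβ.support j hj]
  sum := by simp [hα.sum, ← Finset.mul_sum, hβ.sum]
  sum_smul := by
    simp [_root_.sub_smul, hα.sum_smul, mul_smul, ← Finset.smul_sum, hβ.sum_smul]

theorem isAffineRepr_knotCoeff {v : Fin 3 → Plane} {m : Fin 10 → ℕ} (h : knotTriple v m ≠ none)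
    (x : Plane) : IsAffineRepr v m x (knotCoeff v m x) :=
  have h := knotCoeff_spec v m h x
  ⟨h.2.2, h.2.1, h.1⟩

theorem IsAffineDep.sum_mul_bary {v : Fin 3 → Plane} {m : Fin 10 → ℕ} {α : Fin 10 → ℝ}
    (hα : IsAffineDep v m α) {p : Fin 3 → Plane} (hp : signedArea p ≠ 0) (i : Fin 3) :
    ∑ j, α j * bary p (vertex v j) i = 0 := by
  have h := bary_affineCombination hp (w := α + Pi.single 0 1)
    (by simp [Finset.sum_add_distrib, hα.sum]) (vertex v) i
  simpa [add_smul, add_mul, Finset.sum_add_distrib, hα.sum_smul, Pi.single_apply] using h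

theorem IsAffineDep.eq_zero {v : Fin 3 → Plane} {m : Fin 10 → ℕ} {α : Fin 10 → ℝ}
    (hα : IsAffineDep v m α) {t : Fin 3 → Fin 10} (ht : signedArea (vertex v ∘ t) ≠ 0)
    (h : ∀ j ∉ Set.range t, α j = 0) : α = 0 := by
  funext j
  by_cases hj : j ∈ Set.range t
  · obtain ⟨i, rfl⟩ := hj
    have hsum := hα.sum_mul_bary ht i
    rwa [Finset.sum_eq_single (t i), ← Function.comp_apply (f := vertex v), bary_corner ht,
      if_pos rfl, mul_one] at hsum
    · intro j _ hji
      by_cases hj : j ∈ Set.range t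
      · obtain ⟨l, rfl⟩ := hj
        rw [← Function.comp_apply (f := vertex v), bary_corner ht,
          if_neg (by rintro rfl; simp at hji), mul_zero]
      · rw [h j hj, zero_mul]
    · simp
  · exact h j hj

theorem IsAffineDep.eq_smul {v : Fin 3 → Plane} {t : Fin 3 → Fin 10} {p : Fin 10}
    {α : Fin 10 → ℝ} (hα : IsAffineDep v (∑ i, Pi.single (t i) 1 + Pi.single p 1) α)
    (ht : signedArea (vertex v ∘ t) ≠ 0) :
    α = α p • (Pi.single p 1 - ∑ l, bary (vertex v ∘ t) (vertex v p) l • Pi.single (t l) 1) := by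
  set ε : Fin 10 → ℝ :=
    Pi.single p 1 - ∑ l, bary (vertex v ∘ t) (vertex v p) l • Pi.single (t l) 1 with hε
  have ε_of_notMem {j : Fin 10} (hj : j ∉ Set.range t) : ε j = if j = p then 1 else 0 := by
    have hjt (l : Fin 3) : j ≠ t l := fun h => hj ⟨l, h.symm⟩
    simp [hε, Pi.single_apply, hjt]
  have hdep : IsAffineDep v (∑ i, Pi.single (t i) 1 + Pi.single p 1) ε :=
    { support := fun j hj => by
        obtain ⟨hjt, hjp⟩ := Nat.add_eq_zero_iff.1 hj
        rw [ε_of_notMem (mt (sum_single_ne_zero_iff t).2 (not_not.2 hjt)), if_neg]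
        rintro rfl
        simp at hjp
      sum := by
        simp only [hε, Pi.sub_apply, Finset.sum_apply, Pi.smul_apply, smul_eq_mul,
          Finset.sum_sub_distrib]
        rw [Finset.sum_comm]
        simp [← Finset.mul_sum, sum_bary ht]
      sum_smul := by
        simp only [hε, Pi.sub_apply, Finset.sum_apply, Pi.smul_apply, smul_eq_mul,
          _root_.sub_smul, Finset.sum_sub_distrib, Finset.sum_smul]
        rw [Finset.sum_comm]
        simpa [Pi.single_apply, sub_eq_zero] using (sum_bary_smul ht (vertex v p)).symm }
  refine sub_eq_zero.1 ((hα.sub_smul hdep (α p)).eq_zero ht fun j hj => ?_)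
  rw [Pi.sub_apply, Pi.smul_apply, ε_of_notMem hj, smul_eq_mul, mul_ite, mul_one, mul_zero]
  split_ifs with hjp
  · rw [hjp, sub_self]
  · rw [sub_zero]
    refine hα.support j (Nat.add_eq_zero_iff.2 ⟨?_, by simp [hjp]⟩)
    exact not_not.1 (mt (sum_single_ne_zero_iff t).1 hj)

theorem sum_single_update (t : Fin 3 → Fin 10) (l : Fin 3) (p : Fin 10) :
    ∑ i, Pi.single (t i) 1 + Pi.single p 1 - Pi.single (t l) 1 =
      (∑ i, Pi.single (Function.update t l p i) 1 : Fin 10 → ℕ) := by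
  refine tsub_eq_of_eq_add ?_
  simp only [Fin.sum_univ_three]
  fin_cases l <;> simp <;> abel

theorem exists_eq_sum_single_of_knotTriple {v : Fin 3 → Plane} {m : Fin 10 → ℕ}
    (hm : ∑ j, m j = 4) {a b c : Fin 10} (h : knotTriple v m = some (a, b, c)) :
    ∃ p, m = ∑ i, Pi.single (![a, b, c] i) 1 + Pi.single p 1 := by
  obtain ⟨ha, hb, hc, -⟩ := knotTriple_spec h
  obtain ⟨hab, hbc⟩ := mem_triples.1 (List.mem_of_find?_eq_some h)
  have hb' : (m - Pi.single a 1 : Fin 10 → ℕ) b ≠ 0 := by simpa [hab.ne'] using hb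
  have hc' : (m - Pi.single a 1 - Pi.single b 1 : Fin 10 → ℕ) c ≠ 0 := by
    simpa [(hab.trans hbc).ne', hbc.ne'] using hc
  obtain ⟨q, -, hq⟩ := exists_monotone_eq_sum_single
    (sum_tsub_single (sum_tsub_single (sum_tsub_single hm ha) hb') hc')
  refine ⟨q 0, ?_⟩
  rw [← tsub_add_cancel_of_le (single_le_of_ne_zero ha),
    ← tsub_add_cancel_of_le (single_le_of_ne_zero hb'),
    ← tsub_add_cancel_of_le (single_le_of_ne_zero hc'), hq]
  simp only [Fin.sum_univ_three, Fin.sum_univ_one]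
  simp
  abel

section

variable {v : Fin 3 → Plane} (hv : signedArea v ≠ 0) {k : Fin 12}

include hv

theorem facePiece_zero_eq_sum {a b c p : Fin 10} (hab : a < b) (hbc : b < c) (hc : c < 6)
    (hp : p < 6) (ht : labelDet ![a, b, c] ≠ 0) (x : Plane) :
    facePiece v k 0 (∑ i, Pi.single (![a, b, c] i) 1) x =
      ∑ l, bary (vertex v ∘ ![a, b, c]) (vertex v p) l *
        facePiece v k 0 (∑ i, Pi.single (Function.update ![a, b, c] l p i) 1) x := by
  have mul_eq_sign (t : Fin 3 → Fin 10) :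
      (labelDet t : ℝ) * (if Covers k t then 1728 / |(labelDet t : ℝ)| else 0) =
        1728 * ((labelDet t).sign * (if Covers k t then 1 else 0) : ℤ) := by
    split_ifs with h
    · have habs : |(labelDet t : ℝ)| ≠ 0 := abs_ne_zero.2 (Int.cast_ne_zero.2 h.1)
      rw [mul_div_assoc', div_eq_iff habs, mul_one, mul_assoc, ← Int.cast_abs, ← Int.cast_mul,
        Int.sign_mul_abs]
      ring
    · simp
  have ht' : (labelDet ![a, b, c] : ℝ) ≠ 0 := Int.cast_ne_zero.2 ht
  refine mul_left_cancel₀ ht' ?_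
  simp only [facePiece_zero_sum_single hv, bary_vertex hv, Finset.mul_sum, mul_eq_sign,
    sign_covers_eq_sum k c hc b hbc a hab p hp ht, ← mul_assoc, mul_div_cancel₀ _ ht', Int.cast_sum]

theorem sum_dep_mul_facePiece_zero {m : Fin 10 → ℕ} (hm : ∑ j, m j = 4)
    (hm6 : ∀ j, m j ≠ 0 → j < 6) {α : Fin 10 → ℝ} (hα : IsAffineDep v m α) (x : Plane) :
    ∑ j, α j * facePiece v k 0 (m - Pi.single j 1) x = 0 := by
  rcases hknot : knotTriple v m with _ | ⟨a, b, c⟩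
  · refine Finset.sum_eq_zero fun j _ => ?_
    rcases eq_or_ne (m j) 0 with hj | hj
    · rw [hα.support j hj, zero_mul]
    · rw [facePiece_eq_zero_of_knotTriple (sum_tsub_single hm hj)
        (knotTriple_eq_none_of_le tsub_le_self hknot), mul_zero]
  obtain ⟨-, -, hc, horient⟩ := knotTriple_spec hknot
  obtain ⟨hab, hbc⟩ := mem_triples.1 (List.mem_of_find?_eq_some hknot)
  obtain ⟨p, rfl⟩ := exists_eq_sum_single_of_knotTriple hm hknot
  have ht : signedArea (vertex v ∘ ![a, b, c]) ≠ 0 := horient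
  have hp : p < 6 := hm6 p (by simp)
  have key := facePiece_zero_eq_sum hv (k := k) hab hbc (hm6 c hc) hp
    ((signedArea_vertex_ne_zero_iff hv).1 ht) x
  rw [hα.eq_smul ht]
  simp only [Pi.smul_apply, Pi.sub_apply, Finset.sum_apply, smul_eq_mul, mul_assoc,
    ← Finset.mul_sum, sub_mul, Finset.sum_mul, Finset.sum_sub_distrib]
  rw [Finset.sum_comm]
  simp [Pi.single_apply, key, sum_single_update]

end

section

variable {v : Fin 3 → Plane} {k : Fin 12}

theorem facePiece_succ_of_dep {d : ℕ} {m : Fin 10 → ℕ} {x : Plane} (hm : ∑ j, m j = d + 4)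
    (hdep : ∀ α, IsAffineDep v m α → ∑ j, α j * facePiece v k d (m - Pi.single j 1) x = 0)
    {β : Fin 10 → ℝ} (hβ : IsAffineRepr v m x β) :
    facePiece v k (d + 1) m x = ∑ j, β j * facePiece v k d (m - Pi.single j 1) x := by
  by_cases h : knotTriple v m = none
  · rw [facePiece_eq_zero_of_knotTriple hm h, eq_comm]
    refine Finset.sum_eq_zero fun j _ => ?_
    rcases eq_or_ne (m j) 0 with hj | hj
    · rw [hβ.support j hj, zero_mul]
    · rw [facePiece_eq_zero_of_knotTriple (sum_tsub_single hm hj)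
        (knotTriple_eq_none_of_le tsub_le_self h), mul_zero]
  · have hsub := hdep _ ((isAffineRepr_knotCoeff h x).sub hβ)
    simpa [facePiece, sub_mul, sub_eq_zero] using hsub

theorem tsub_single_apply_eq_zero {m : Fin 10 → ℕ} {i j : Fin 10}
    (h : (m - Pi.single i 1 : Fin 10 → ℕ) j = 0) : j = i ∨ m j = 0 := by
  by_contra! hij
  simp [hij.1, hij.2] at h

theorem sum_mul_swap_eq_zero {ι : Type*} [Fintype ι] (α β : ι → ℝ) {G : ι → ι → ℝ}
    (hG : ∀ i j, G i j = G j i) : ∑ i, ∑ j, (α i * β j - β i * α j) * G i j = 0 := by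
  simp only [sub_mul, Finset.sum_sub_distrib]
  rw [sub_eq_zero, Finset.sum_comm]
  simp only [hG, mul_comm]

/-- Eliminating the knot `i` with the dependency turns a representation of `x` by the knots `m` into
one by the knots `m - i`. -/
theorem dep_mul_facePiece_succ {d : ℕ} {m : Fin 10 → ℕ} {x : Plane} (hm : ∑ j, m j = d + 5)
    {i : Fin 10} (hi : m i ≠ 0)
    (hdep : ∀ α, IsAffineDep v (m - Pi.single i 1) α →
      ∑ j, α j * facePiece v k d (m - Pi.single i 1 - Pi.single j 1) x = 0)
    {α β : Fin 10 → ℝ} (hα : IsAffineDep v m α) (hβ : IsAffineRepr v m x β) :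
    α i * facePiece v k (d + 1) (m - Pi.single i 1) x =
      ∑ j, (α i * β j - β i * α j) * facePiece v k d (m - Pi.single i 1 - Pi.single j 1) x := by
  by_cases hαi : α i = 0
  · have h := hdep α ⟨fun j hj => (tsub_single_apply_eq_zero hj).elim (fun h => h ▸ hαi)
      (hα.support j), hα.sum, hα.sum_smul⟩
    simp [hαi, mul_assoc, ← Finset.mul_sum, h]
  · have hγ := hβ.sub_smul hα (β i / α i)
    rw [facePiece_succ_of_dep (sum_tsub_single hm hi) hdep ⟨fun j hj => ?_, hγ.sum, hγ.sum_smul⟩,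
      Finset.mul_sum]
    · refine Finset.sum_congr rfl fun j _ => ?_
      rw [← mul_assoc, Pi.sub_apply, Pi.smul_apply, smul_eq_mul, mul_sub, ← mul_assoc,
        mul_div_cancel₀ _ hαi]
    · rcases tsub_single_apply_eq_zero hj with rfl | hj
      · simp [hαi]
      · exact hγ.support j hj

theorem sum_dep_mul_facePiece (hv : signedArea v ≠ 0) {d : ℕ} {m : Fin 10 → ℕ}
    (hm : ∑ j, m j = d + 4) (hm6 : ∀ j, m j ≠ 0 → j < 6) {α : Fin 10 → ℝ}
    (hα : IsAffineDep v m α) (x : Plane) :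
    ∑ j, α j * facePiece v k d (m - Pi.single j 1) x = 0 := by
  induction d generalizing m α with
  | zero => exact sum_dep_mul_facePiece_zero hv hm hm6 hα x
  | succ d ih =>
    by_cases h : knotTriple v m = none
    · refine Finset.sum_eq_zero fun j _ => ?_
      rw [facePiece, knotCoeff_eq_zero (knotTriple_eq_none_of_le tsub_le_self h)]
      simp
    have hβ := isAffineRepr_knotCoeff h x
    rw [← sum_mul_swap_eq_zero α (knotCoeff v m x)
      (G := fun i j => facePiece v k d (m - Pi.single i 1 - Pi.single j 1) x)
      fun i j => by rw [tsub_right_comm]]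
    refine Finset.sum_congr rfl fun i _ => ?_
    by_cases hi : m i = 0
    · simp [hα.support i hi, hβ.support i hi]
    · refine dep_mul_facePiece_succ hm hi (fun α' hα' => ?_) hα hβ
      exact ih (sum_tsub_single hm hi) (fun j hj => hm6 j fun h0 => hj (by simp [h0])) hα'

theorem facePiece_succ (hv : signedArea v ≠ 0) {d : ℕ} {m : Fin 10 → ℕ}
    (hm : ∑ j, m j = d + 4) (hm6 : ∀ j, m j ≠ 0 → j < 6) {x : Plane} {β : Fin 10 → ℝ}
    (hβ : IsAffineRepr v m x β) :
    facePiece v k (d + 1) m x = ∑ j, β j * facePiece v k d (m - Pi.single j 1) x :=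
  facePiece_succ_of_dep hm (fun _ hα => sum_dep_mul_facePiece hv hm hm6 hα x) hβ

end

section

variable {v : Fin 3 → Plane} (hv : signedArea v ≠ 0) {k : Fin 12}

include hv

theorem facePiece_succ_bary {d : ℕ} {m : Fin 10 → ℕ} (hm : ∑ j, m j = d + 4)
    (hm6 : ∀ j, m j ≠ 0 → j < 6) {t : Fin 3 → Fin 10} (ht : labelDet t ≠ 0)
    (hmt : ∀ l, m (t l) ≠ 0) (x : Plane) :
    facePiece v k (d + 1) m x =
      ∑ l, bary (vertex v ∘ t) x l * facePiece v k d (m - Pi.single (t l) 1) x := by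
  have ht' := (signedArea_vertex_ne_zero_iff hv).2 ht
  have hβ : IsAffineRepr v m x (∑ l, bary (vertex v ∘ t) x l • Pi.single (t l) 1) :=
    { support := fun j hj => by
        have hjt (l : Fin 3) : j ≠ t l := by
          rintro rfl
          exact hmt l hj
        simp [hjt]
      sum := by
        simp only [Finset.sum_apply, Pi.smul_apply, smul_eq_mul]
        rw [Finset.sum_comm]
        simp [← Finset.mul_sum, sum_bary ht']
      sum_smul := by
        simp only [Finset.sum_apply, Pi.smul_apply, smul_eq_mul, Finset.sum_smul]
        rw [Finset.sum_comm]
        simpa [Pi.single_apply] using sum_bary_smul ht' x }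
  rw [facePiece_succ hv hm hm6 hβ]
  simp only [Finset.sum_apply, Pi.smul_apply, smul_eq_mul, Finset.sum_mul]
  rw [Finset.sum_comm]
  simp [Pi.single_apply]

end

/-! ### Gluing smooth functions -/

section

variable {E F : Type*} [NormedAddCommGroup E] [NormedSpace ℝ E] [NormedAddCommGroup F]
  [NormedSpace ℝ F]

theorem hasFTaylorSeriesUpToOn_iUnion {ι : Type*} [Finite ι] {n : WithTop ℕ∞} {f : E → F}
    {p : E → FormalMultilinearSeries ℝ E F} {s : ι → Set E} (hs : ∀ k, IsClosed (s k))
    (h : ∀ k, HasFTaylorSeriesUpToOn n f p (s k)) : HasFTaylorSeriesUpToOn n f p (⋃ k, s k) where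
  zero_eq x hx :=
    have ⟨k, hk⟩ := Set.mem_iUnion.1 hx
    (h k).zero_eq x hk
  fderivWithin m hm x _ := by
    have hk (k : ι) : HasFDerivWithinAt (p · m) (p x m.succ).curryLeft (s k) x := by
      by_cases hx : x ∈ s k
      · exact (h k).fderivWithin m hm x hx
      · exact .of_notMem_closure ((hs k).closure_eq.symm ▸ hx)
    simp only [hasFDerivWithinAt_iff_isLittleO, nhdsWithin_iUnion,
      Asymptotics.isLittleO_iff, Filter.eventually_iSup] at hk ⊢
    exact fun c hc k => hk k hc
  cont m hm := (locallyFinite_of_finite s).continuousOn_iUnion hs fun k => (h k).cont m hm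

theorem contDiffOn_iUnion_of_iteratedFDeriv_eq {ι : Type*} [Finite ι] {n : ℕ} {f : E → F}
    {g : ι → E → F} {s : ι → Set E} (hs : ∀ k, IsClosed (s k)) (hg : ∀ k, ContDiff ℝ n (g k))
    (hfg : ∀ k, Set.EqOn f (g k) (s k))
    (hjet : ∀ k l, ∀ x ∈ s k ∩ s l, ∀ i ≤ n,
      iteratedFDeriv ℝ i (g k) x = iteratedFDeriv ℝ i (g l) x) :
    ContDiffOn ℝ n f (⋃ k, s k) := by
  classical
  let p (x : E) : FormalMultilinearSeries ℝ E F :=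
    if hx : ∃ k, x ∈ s k then ftaylorSeries ℝ (g hx.choose) x else 0
  suffices h : HasFTaylorSeriesUpToOn n f p (⋃ k, s k) from h.contDiffOn
  refine hasFTaylorSeriesUpToOn_iUnion hs fun k => ?_
  refine HasFTaylorSeriesUpToOn.congr ?_ (hfg k)
  refine ((hg k).ftaylorSeries.hasFTaylorSeriesUpToOn (s k)).congr_series fun m hm x hx => ?_
  have hex : ∃ k, x ∈ s k := ⟨k, hx⟩
  simp only [p, dif_pos hex]
  exact hjet _ _ x ⟨hx, hex.choose_spec⟩ m (by exact_mod_cast hm)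

theorem iteratedFDeriv_pow_mul_eq_zero {ℓ g : E → ℝ} {n i : ℕ} (hi : i < n)
    (hℓ : ContDiff ℝ i ℓ) (hg : ContDiff ℝ i g) {x : E} (hx : ℓ x = 0) :
    iteratedFDeriv ℝ i (fun y => ℓ y ^ n * g y) x = 0 := by
  induction n generalizing i with
  | zero => simp at hi
  | succ n ih =>
    have hpow : (fun y => ℓ y ^ (n + 1) * g y) = fun y => ℓ y * (ℓ y ^ n * g y) := by
      funext y
      ring
    rw [hpow, ← norm_le_zero_iff]
    refine (norm_iteratedFDeriv_mul_le hℓ ((hℓ.pow n).mul hg) x le_rfl).trans_eq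
      (Finset.sum_eq_zero fun j hj => ?_)
    rcases j.eq_zero_or_pos with rfl | hj0
    · simp [norm_iteratedFDeriv_zero, hx]
    · have hle : ((i - j : ℕ) : WithTop ℕ∞) ≤ i := by exact_mod_cast i.sub_le j
      rw [Finset.mem_range] at hj
      rw [ih (by lia) (hℓ.of_le hle) (hg.of_le hle), norm_zero, mul_zero]

end

/-! ### Polynomial functions on the plane -/

/-- The function `f` is a polynomial of degree at most `n` in the coordinates. -/
def IsPolynomial (n : ℕ) (f : Plane → ℝ) : Prop :=
  ∃ p : MvPolynomial (Fin 2) ℝ, p.totalDegree ≤ n ∧ ∀ x, f x = MvPolynomial.eval (fun i => x i) p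

theorem isPolynomial_const (n : ℕ) (a : ℝ) : IsPolynomial n fun _ => a :=
  ⟨MvPolynomial.C a, by simp, by simp⟩

theorem isPolynomial_coord (i : Fin 2) : IsPolynomial 1 fun x => x i :=
  ⟨MvPolynomial.X i, by simp, by simp⟩

theorem IsPolynomial.add {n : ℕ} {f g : Plane → ℝ} (hf : IsPolynomial n f)
    (hg : IsPolynomial n g) : IsPolynomial n fun x => f x + g x := by
  obtain ⟨p, hp, hfp⟩ := hf
  obtain ⟨q, hq, hgq⟩ := hg
  exact ⟨p + q, (p.totalDegree_add q).trans (max_le hp hq), by simp [hfp, hgq]⟩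

theorem IsPolynomial.mul {n k : ℕ} {f g : Plane → ℝ} (hf : IsPolynomial n f)
    (hg : IsPolynomial k g) : IsPolynomial (n + k) fun x => f x * g x := by
  obtain ⟨p, hp, hfp⟩ := hf
  obtain ⟨q, hq, hgq⟩ := hg
  exact ⟨p * q, (p.totalDegree_mul q).trans (add_le_add hp hq), by simp [hfp, hgq]⟩

theorem IsPolynomial.sum {ι : Type*} {n : ℕ} {s : Finset ι} {f : ι → Plane → ℝ}
    (h : ∀ i ∈ s, IsPolynomial n (f i)) : IsPolynomial n fun x => ∑ i ∈ s, f i x := by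
  classical
  induction s using Finset.induction_on with
  | empty => simpa using isPolynomial_const n 0
  | insert i s hi ih =>
    simp only [Finset.sum_insert hi]
    exact (h i (by simp)).add (ih fun j hj => h j (by simp [hj]))

theorem IsPolynomial.contDiff {n : ℕ} {f : Plane → ℝ} (hf : IsPolynomial n f) {r : WithTop ℕ∞} :
    ContDiff ℝ r f := by
  obtain ⟨p, -, hp⟩ := hf
  have han := AnalyticOnNhd.aeval_mvPolynomial (𝕜 := ℝ) (s := Set.univ)
    (f := fun (x : Plane) i => x i) (fun i => (EuclideanSpace.proj (𝕜 := ℝ) i).analyticOnNhd _) p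
  rw [funext hp]
  exact contDiffOn_univ.1 (han.contDiffOn uniqueDiffOn_univ)

theorem isPolynomial_affine (a b c : ℝ) : IsPolynomial 1 fun x => a * x 0 + b * x 1 + c :=
  ((((isPolynomial_const 0 a).mul (isPolynomial_coord 0)).add
    ((isPolynomial_const 0 b).mul (isPolynomial_coord 1)))).add (isPolynomial_const _ c)

theorem isPolynomial_bary (p : Fin 3 → Plane) (i : Fin 3) : IsPolynomial 1 fun x => bary p x i := by
  obtain ⟨a, b, c, h⟩ : ∃ a b c : ℝ,
      ∀ x : Plane, signedArea (Function.update p i x) = a * x 0 + b * x 1 + c := by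
    fin_cases i
    · exact ⟨p 1 1 - p 2 1, p 2 0 - p 1 0, p 1 0 * p 2 1 - p 1 1 * p 2 0, fun x => by
        simp only [Fin.zero_eta, signedArea_update_zero, orient]; ring⟩
    · exact ⟨p 2 1 - p 0 1, p 0 0 - p 2 0, p 2 0 * p 0 1 - p 2 1 * p 0 0, fun x => by
        simp only [Fin.mk_one, signedArea_update_one, orient]; ring⟩
    · exact ⟨p 0 1 - p 1 1, p 1 0 - p 0 0, p 0 0 * p 1 1 - p 0 1 * p 1 0, fun x => by
        simp only [Fin.reduceFinMk, signedArea_update_two, orient]; ring⟩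
  have hdiv : (fun x => bary p x i) = fun x => (signedArea p)⁻¹ * (a * x 0 + b * x 1 + c) :=
    funext fun x => by rw [bary, h, div_eq_inv_mul]
  rw [hdiv]
  exact (isPolynomial_const 0 _).mul (isPolynomial_affine a b c)

theorem isPolynomial_knotCoeff (v : Fin 3 → Plane) (m : Fin 10 → ℕ) (j : Fin 10) :
    IsPolynomial 1 fun x => knotCoeff v m x j := by
  rcases h : knotTriple v m with _ | ⟨a, b, c⟩
  · simpa [knotCoeff_eq_zero h] using isPolynomial_const 1 0
  · have hsum : (fun x => knotCoeff v m x j) = fun x => ∑ i,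
        (Pi.single (![a, b, c] i) 1 : Fin 10 → ℝ) j *
          bary (vertex v ∘ ![a, b, c]) x i := by
      funext x
      simp [knotCoeff, h, Fin.sum_univ_three, Pi.single_apply, bary, signedArea]
    rw [hsum]
    exact IsPolynomial.sum fun i _ => (isPolynomial_const 0 _).mul (isPolynomial_bary _ i)

theorem isPolynomial_facePiece (v : Fin 3 → Plane) (k : Fin 12) (d : ℕ) (m : Fin 10 → ℕ) :
    IsPolynomial d (facePiece v k d m) := by
  induction d generalizing m with
  | zero => exact isPolynomial_const 0 _
  | succ d ih =>
    have h : IsPolynomial (1 + d) (facePiece v k (d + 1) m) :=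
      IsPolynomial.sum fun j _ => (isPolynomial_knotCoeff v m j).mul (ih _)
    rwa [Nat.add_comm] at h

/-! ### Smoothness of simplex splines -/

/-- Two labels on each of the six lines of the split that meet the interior of the triangle: the
three medians and the three lines through midpoints of edges. -/
def lineLabel : Fin 6 → Fin 2 → Fin 10 :=
  ![![0, 4], ![1, 5], ![2, 3], ![3, 4], ![4, 5], ![3, 5]]

/-- Twice the signed area of the triangle spanned by `x` and two points of the line `L`: an
equation of that line. -/
noncomputable def lineForm (v : Fin 3 → Plane) (L : Fin 6) (x : Plane) : ℝ :=
  orient (vertex v (lineLabel L 0)) (vertex v (lineLabel L 1)) x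

/-- A number whose sign tells on which side of the line `L` the face `k` lies. -/
def faceSide (k : Fin 12) (L : Fin 6) : ℤ :=
  ∑ i, labelDet ![lineLabel L 0, lineLabel L 1, faceCorner k i]

/-- The lines with the faces `k` and `l` on different sides. -/
def separating (k l : Fin 12) : Finset (Fin 6) := {L | faceSide k L * faceSide l L < 0}

theorem lineLabel_zero_ne_one : ∀ L, lineLabel L 0 ≠ lineLabel L 1 := by
  decide

theorem labelDet_lineLabel_ne_zero : ∀ L, ∀ c < 6, c ≠ lineLabel L 0 → c ≠ lineLabel L 1 →
    labelDet ![lineLabel L 0, lineLabel L 1, c] ≠ 0 := by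
  decide

theorem faceSide_mul_labelDet_nonneg : ∀ k L i,
    0 ≤ faceSide k L * labelDet ![lineLabel L 0, lineLabel L 1, faceCorner k i] := by
  decide +kernel

set_option synthInstance.maxSize 500 in
theorem covers_congr_of_separating : ∀ k l L, separating k l = {L} → ∀ a < 6, ∀ b < 6, ∀ c < 6,
    (lineLabel L 0 ∉ [a, b, c] ∨ lineLabel L 1 ∉ [a, b, c]) →
      (Covers k ![a, b, c] ↔ Covers l ![a, b, c]) := by
  decide +kernel

theorem exists_separating_eq_singleton : ∀ k l, k ≠ l → ∃ L ∈ separating k l, ∃ k',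
    separating k k' = {L} ∧ separating k' l = (separating k l).erase L := by
  decide +kernel

theorem orient_sum_smul (p q : Plane) {w : Fin 3 → ℝ} (hw : ∑ i, w i = 1) (r : Fin 3 → Plane) :
    orient p q (∑ i, w i • r i) = ∑ i, w i * orient p q (r i) := by
  simp only [Fin.sum_univ_three] at hw ⊢
  simp only [orient, PiLp.add_apply, PiLp.smul_apply, smul_eq_mul]
  linear_combination (p 1 * (q 0 - p 0) - p 0 * (q 1 - p 1)) * (hw : w 0 + w 1 + w 2 = 1)

section

variable {v : Fin 3 → Plane} {L : Fin 6}

theorem lineForm_vertex (v : Fin 3 → Plane) (L : Fin 6) (j : Fin 10) :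
    lineForm v L (vertex v j) =
      labelDet ![lineLabel L 0, lineLabel L 1, j] / 1728 * signedArea v :=
  signedArea_vertex v ![lineLabel L 0, lineLabel L 1, j]

theorem contDiff_lineForm {r : WithTop ℕ∞} : ContDiff ℝ r (lineForm v L) := by
  have h (i : Fin 2) : ContDiff ℝ r fun x : Plane => x i := (isPolynomial_coord i).contDiff
  exact (contDiff_const.mul ((h 1).sub contDiff_const)).sub
    (contDiff_const.mul ((h 0).sub contDiff_const))

theorem faceSide_mul_lineForm_nonneg {k : Fin 12} {x : Plane} (hv : signedArea v ≠ 0)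
    (hx : x ∈ face v k) : 0 ≤ faceSide k L * (lineForm v L x / signedArea v) := by
  have hk := (signedArea_vertex_ne_zero_iff hv).2 (labelDet_faceCorner_ne_zero k)
  rw [face_eq, mem_convexHull_range_iff hk] at hx
  rw [← sum_bary_smul hk x, lineForm, orient_sum_smul _ _ (sum_bary hk x), Finset.sum_div,
    Finset.mul_sum]
  refine Finset.sum_nonneg fun i _ => ?_
  have h : (0 : ℝ) ≤
      (faceSide k L * labelDet ![lineLabel L 0, lineLabel L 1, faceCorner k i] : ℤ) :=
    Int.cast_nonneg (faceSide_mul_labelDet_nonneg k L i)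
  have hform := lineForm_vertex v L (faceCorner k i)
  rw [lineForm] at hform
  rw [Function.comp_apply, hform, mul_div_assoc, mul_div_cancel_right₀ _ hv]
  push_cast at h
  have := mul_nonneg (hx i) h
  linarith

theorem lineForm_eq_zero_of_mem_separating {k l : Fin 12} {x : Plane} (hv : signedArea v ≠ 0)
    (hk : x ∈ face v k) (hl : x ∈ face v l) (hL : L ∈ separating k l) : lineForm v L x = 0 := by
  have hneg : faceSide k L * faceSide l L < 0 := by simpa [separating] using hL
  have hneg' : (faceSide k L * faceSide l L : ℝ) < 0 := by exact_mod_cast hneg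
  have hprod := mul_nonneg (faceSide_mul_lineForm_nonneg (L := L) hv hk)
    (faceSide_mul_lineForm_nonneg (L := L) hv hl)
  have hsq : (lineForm v L x / signedArea v) ^ 2 = 0 := by
    nlinarith [sq_nonneg (lineForm v L x / signedArea v)]
  simpa [hv] using hsq

end

theorem exists_knot_ne {m : Fin 10 → ℕ} {L : Fin 6}
    (h : m (lineLabel L 0) + m (lineLabel L 1) < ∑ j, m j) :
    ∃ c, m c ≠ 0 ∧ c ≠ lineLabel L 0 ∧ c ≠ lineLabel L 1 := by
  by_contra! hm
  rw [← Finset.sum_pair (lineLabel_zero_ne_one L),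
    Finset.sum_subset (Finset.subset_univ _) fun c _ hc => ?_] at h
  · exact h.false
  · by_contra hmc
    simp only [Finset.mem_insert, Finset.mem_singleton, not_or] at hc
    exact hc.2 (hm c hmc hc.1)

section

variable {v : Fin 3 → Plane} (hv : signedArea v ≠ 0) {k l : Fin 12} {L : Fin 6}
  (hkl : separating k l = {L}) {d : ℕ} {m : Fin 10 → ℕ}

include hv hkl

theorem facePiece_congr_of_separating (hm : ∑ j, m j = d + 3) (hm6 : ∀ j, m j ≠ 0 → j < 6)
    (hL : m (lineLabel L 0) = 0 ∨ m (lineLabel L 1) = 0) (x : Plane) :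
    facePiece v k d m x = facePiece v l d m x := by
  induction d generalizing m with
  | zero =>
    obtain ⟨t, -, rfl⟩ := exists_monotone_eq_sum_single hm
    have h6 (i : Fin 3) : t i < 6 := hm6 _ ((sum_single_ne_zero_iff t).2 ⟨i, rfl⟩)
    have notMem {j : Fin 10} (hj : (∑ i, Pi.single (t i) 1 : Fin 10 → ℕ) j = 0) :
        j ∉ [t 0, t 1, t 2] := by
      have hj' := mt (sum_single_ne_zero_iff t).2 (not_not.2 hj)
      rintro h
      simp only [List.mem_cons, List.not_mem_nil, or_false] at h
      rcases h with rfl | rfl | rfl <;> exact hj' ⟨_, rfl⟩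
    have hcov := covers_congr_of_separating k l L hkl _ (h6 0) _ (h6 1) _ (h6 2)
      (hL.imp notMem notMem)
    have ht3 : t = ![t 0, t 1, t 2] := by
      ext i
      fin_cases i <;> rfl
    rw [facePiece_zero_sum_single hv, facePiece_zero_sum_single hv]
    rw [← ht3] at hcov
    simp only [hcov]
  | succ d ih =>
    simp only [facePiece]
    refine Finset.sum_congr rfl fun j _ => ?_
    by_cases hj : m j = 0
    · by_cases h : knotTriple v m = none
      · simp [knotCoeff_eq_zero h]
      · rw [(isAffineRepr_knotCoeff h x).support j hj, zero_mul, zero_mul]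
    · rw [ih (sum_tsub_single hm hj) (fun i hi => hm6 i fun h0 => hi (by simp [h0]))
        (hL.imp (fun h => by simp [h]) fun h => by simp [h])]

omit hkl in
theorem facePiece_succ_sub_eq {c : Fin 10} {n : ℕ} {x : Plane} {y : Fin 3 → ℝ}
    (hm : ∑ j, m j = d + 4) (hm6 : ∀ j, m j ≠ 0 → j < 6)
    (ht : labelDet ![lineLabel L 0, lineLabel L 1, c] ≠ 0)
    (hmt : ∀ i, m (![lineLabel L 0, lineLabel L 1, c] i) ≠ 0)
    (h0 : facePiece v k d (m - Pi.single (lineLabel L 0) 1) x -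
      facePiece v l d (m - Pi.single (lineLabel L 0) 1) x = lineForm v L x ^ (n + 1) * y 0)
    (h1 : facePiece v k d (m - Pi.single (lineLabel L 1) 1) x -
      facePiece v l d (m - Pi.single (lineLabel L 1) 1) x = lineForm v L x ^ (n + 1) * y 1)
    (h2 : facePiece v k d (m - Pi.single c 1) x - facePiece v l d (m - Pi.single c 1) x =
      lineForm v L x ^ n * y 2) :
    facePiece v k (d + 1) m x - facePiece v l (d + 1) m x = lineForm v L x ^ (n + 1) *
      (bary (vertex v ∘ ![lineLabel L 0, lineLabel L 1, c]) x 0 * y 0 +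
        bary (vertex v ∘ ![lineLabel L 0, lineLabel L 1, c]) x 1 * y 1 +
        (signedArea (vertex v ∘ ![lineLabel L 0, lineLabel L 1, c]))⁻¹ * y 2) := by
  have hbary : bary (vertex v ∘ ![lineLabel L 0, lineLabel L 1, c]) x 2 =
      (signedArea (vertex v ∘ ![lineLabel L 0, lineLabel L 1, c]))⁻¹ * lineForm v L x :=
    div_eq_inv_mul _ _
  rw [facePiece_succ_bary hv hm hm6 ht hmt, facePiece_succ_bary hv hm hm6 ht hmt,
    ← Finset.sum_sub_distrib]
  simp only [← mul_sub, Fin.sum_univ_three, Matrix.cons_val, h0, h1, h2, hbary]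
  ring

theorem exists_facePiece_sub_eq_of_le (hm : ∑ j, m j = d + 3) (hm6 : ∀ j, m j ≠ 0 → j < 6)
    (hL : m (lineLabel L 0) = 0 ∨ m (lineLabel L 1) = 0 ∨
      d + 2 ≤ m (lineLabel L 0) + m (lineLabel L 1)) :
    ∃ g : Plane → ℝ, (∀ r : WithTop ℕ∞, ContDiff ℝ r g) ∧ ∀ x,
      facePiece v k d m x - facePiece v l d m x =
        lineForm v L x ^ (d + 2 - (m (lineLabel L 0) + m (lineLabel L 1))) * g x := by
  rcases or_assoc.2 hL with h | h
  · exact ⟨0, fun _ => contDiff_const, fun x => by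
      simp [facePiece_congr_of_separating hv hkl hm hm6 h x]⟩
  · refine ⟨fun x => facePiece v k d m x - facePiece v l d m x, fun _ =>
      (isPolynomial_facePiece v k d m).contDiff.sub (isPolynomial_facePiece v l d m).contDiff,
      fun x => ?_⟩
    rw [Nat.sub_eq_zero_of_le h, pow_zero, one_mul]

/-- Across a line of the split a simplex spline of degree `d` loses one derivative for each
knot on the line: the difference of its two polynomial pieces is divisible by the corresponding
power of the equation of the line. -/
theorem exists_facePiece_sub_eq (hm : ∑ j, m j = d + 3) (hm6 : ∀ j, m j ≠ 0 → j < 6) :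
    ∃ g : Plane → ℝ, (∀ r : WithTop ℕ∞, ContDiff ℝ r g) ∧ ∀ x,
      facePiece v k d m x - facePiece v l d m x =
        lineForm v L x ^ (d + 2 - (m (lineLabel L 0) + m (lineLabel L 1))) * g x := by
  induction d generalizing m with
  | zero => exact exists_facePiece_sub_eq_of_le hv hkl hm hm6 (by omega)
  | succ d ih =>
    by_cases hL : m (lineLabel L 0) = 0 ∨ m (lineLabel L 1) = 0 ∨
      d + 3 ≤ m (lineLabel L 0) + m (lineLabel L 1)
    · exact exists_facePiece_sub_eq_of_le hv hkl hm hm6 hL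
    push Not at hL
    obtain ⟨hL0, hL1, hd⟩ := hL
    obtain ⟨c, hc, hca, hcb⟩ := exists_knot_ne (L := L) (m := m) (by omega)
    have ht := labelDet_lineLabel_ne_zero L c (hm6 c hc) hca hcb
    have hmt : ∀ i, m (![lineLabel L 0, lineLabel L 1, c] i) ≠ 0 :=
      Fin.forall_fin_succ.2 ⟨hL0, Fin.forall_fin_two.2 ⟨hL1, hc⟩⟩
    choose g hg hgx using fun i => ih (sum_tsub_single hm (hmt i))
      fun j hj => hm6 j fun h0 => hj (by simp [h0])
    let t := ![lineLabel L 0, lineLabel L 1, c]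
    refine ⟨fun x => bary (vertex v ∘ t) x 0 * g 0 x + bary (vertex v ∘ t) x 1 * g 1 x +
      (signedArea (vertex v ∘ t))⁻¹ * g 2 x, fun r => ?_, fun x => ?_⟩
    · have hbary (i : Fin 3) := (isPolynomial_bary (vertex v ∘ t) i).contDiff (r := r)
      exact (((hbary 0).mul (hg 0 r)).add ((hbary 1).mul (hg 1 r))).add
        (contDiff_const.mul (hg 2 r))
    · have h0 := hgx 0 x
      have h1 := hgx 1 x
      have h2 := hgx 2 x
      have hab := lineLabel_zero_ne_one L
      simp only [Matrix.cons_val, Pi.sub_apply, Pi.single_eq_same, Pi.single_eq_of_ne hab,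
        Pi.single_eq_of_ne hab.symm, Pi.single_eq_of_ne hca.symm, Pi.single_eq_of_ne hcb.symm,
        tsub_zero] at h0 h1 h2
      obtain ⟨n, hn⟩ := Nat.exists_eq_add_of_lt hd
      rw [show d + 2 - (m (lineLabel L 0) - 1 + m (lineLabel L 1)) = n + 1 by omega] at h0
      rw [show d + 2 - (m (lineLabel L 0) + (m (lineLabel L 1) - 1)) = n + 1 by omega] at h1
      rw [show d + 2 - (m (lineLabel L 0) + m (lineLabel L 1)) = n by omega] at h2
      rw [show d + 1 + 2 - (m (lineLabel L 0) + m (lineLabel L 1)) = n + 1 by omega]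
      exact facePiece_succ_sub_eq hv hm hm6 ht hmt (y := fun i => g i x) h0 h1 h2

end

/-- The condition on the knots that makes a quintic simplex spline `C³` across every line of the
split. -/
def IsSmoothKnots (m : Fin 10 → ℕ) : Prop :=
  ∑ j, m j = 8 ∧ (∀ j, m j ≠ 0 → j < 6) ∧ ∀ L,
    m (lineLabel L 0) = 0 ∨ m (lineLabel L 1) = 0 ∨ m (lineLabel L 0) + m (lineLabel L 1) ≤ 3

instance (m : Fin 10 → ℕ) : Decidable (IsSmoothKnots m) := inferInstanceAs (Decidable (_ ∧ _))

section

variable {v : Fin 3 → Plane} (hv : signedArea v ≠ 0) {k l : Fin 12} {m : Fin 10 → ℕ}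
  (hm : IsSmoothKnots m)

include hv hm

theorem IsSmoothKnots.iteratedFDeriv_facePiece_eq_of_separating {L : Fin 6}
    (hkl : separating k l = {L}) {x : Plane} (hx : lineForm v L x = 0) {i : ℕ} (hi : i ≤ 3) :
    iteratedFDeriv ℝ i (facePiece v k 5 m) x = iteratedFDeriv ℝ i (facePiece v l 5 m) x := by
  obtain ⟨hsum, hm6, hL⟩ := hm
  have hkd := (isPolynomial_facePiece v k 5 m).contDiff (r := i)
  have hld := (isPolynomial_facePiece v l 5 m).contDiff (r := i)
  rcases or_assoc.2 (hL L) with h | h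
  · rw [funext (facePiece_congr_of_separating hv hkl hsum hm6 h)]
  · obtain ⟨g, hg, hgx⟩ := exists_facePiece_sub_eq hv hkl hsum hm6
    rw [← sub_eq_zero, ← iteratedFDeriv_sub_apply hkd.contDiffAt hld.contDiffAt,
      show facePiece v k 5 m - facePiece v l 5 m = _ from funext hgx]
    exact iteratedFDeriv_pow_mul_eq_zero (by omega) contDiff_lineForm (hg _) hx

theorem IsSmoothKnots.iteratedFDeriv_facePiece_eq {x : Plane}
    (hx : ∀ L ∈ separating k l, lineForm v L x = 0) {i : ℕ} (hi : i ≤ 3) :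
    iteratedFDeriv ℝ i (facePiece v k 5 m) x = iteratedFDeriv ℝ i (facePiece v l 5 m) x := by
  induction hn : (separating k l).card generalizing k with
  | zero =>
    have hkl : k = l := by
      by_contra hne
      obtain ⟨L, hL, -⟩ := exists_separating_eq_singleton k l hne
      exact Finset.card_ne_zero_of_mem hL hn
    rw [hkl]
  | succ n ih =>
    have hne : k ≠ l := by
      rintro rfl
      obtain ⟨L, hL⟩ : (separating k k).Nonempty := Finset.card_pos.1 (by omega)
      exact (mul_self_nonneg (faceSide k L)).not_gt (by simpa [separating] using hL)
    obtain ⟨L, hL, k', hkk', hk'l⟩ := exists_separating_eq_singleton k l hne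
    rw [hm.iteratedFDeriv_facePiece_eq_of_separating hv hkk' (hx L hL) hi]
    refine ih (fun L' hL' => hx L' ?_) (by rw [hk'l, Finset.card_erase_of_mem hL, hn]; rfl)
    exact Finset.mem_of_mem_erase (hk'l ▸ hL')

theorem IsSmoothKnots.iteratedFDeriv_facePiece_eq_of_mem_face {x : Plane} (hk : x ∈ face v k)
    (hl : x ∈ face v l) {i : ℕ} (hi : i ≤ 3) :
    iteratedFDeriv ℝ i (facePiece v k 5 m) x = iteratedFDeriv ℝ i (facePiece v l 5 m) x :=
  hm.iteratedFDeriv_facePiece_eq hv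
    (fun _ => lineForm_eq_zero_of_mem_separating hv hk hl) hi

theorem IsSmoothKnots.simplexSpline_eq {x : Plane} (hx : x ∈ face v k) :
    simplexSpline v 5 m x = facePiece v k 5 m x := by
  obtain ⟨l, hl⟩ := exists_mem_halfOpenFace hv (face_subset_triangle v k hx)
  rw [simplexSpline_eq_facePiece hl]
  have h := hm.iteratedFDeriv_facePiece_eq_of_mem_face hv hl.1 hx (i := 0) (by norm_num)
  simpa using congrArg (fun f => f 0) h

theorem IsSmoothKnots.simplexSpline_mem_splineSpace :
    simplexSpline v 5 m ∈ splineSpace v := by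
  refine ⟨?_, fun k => ?_⟩
  · rw [← iUnion_face hv]
    exact contDiffOn_iUnion_of_iteratedFDeriv_eq (fun k => isClosed_face v k)
      (fun k => (isPolynomial_facePiece v k 5 m).contDiff)
      (fun k x hx => hm.simplexSpline_eq hv hx)
      fun k l x hx i hi => hm.iteratedFDeriv_facePiece_eq_of_mem_face hv hx.1 hx.2 hi
  · obtain ⟨p, hp, hpx⟩ := isPolynomial_facePiece v k 5 m
    exact ⟨p, hp, fun x hx => (hm.simplexSpline_eq hv hx).trans (hpx x)⟩

end

/-! ### The face polynomials in local coordinates -/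

/-- The triples of labels below `6`, in increasing order, whose triangle contains the face `k`. -/
def coveringTriples (k : Fin 12) : List (Fin 3 → Fin 10) :=
  (triples.map fun t => ![t.1, t.2.1, t.2.2]).filter fun t => t 2 < 6 ∧ Covers k t

/-- A multiset of labels as a number: the multiplicity of the label `j`, assumed to be less than
`8`, is the digit of `8 ^ j`. -/
def code (m : Fin 10 → ℕ) : ℕ := ∑ j, m j * 8 ^ (j : ℕ)

/-- The multiplicity of the label `j` in the multiset with code `n`. -/
def codeDigit (n : ℕ) (j : Fin 10) : ℕ := n / 8 ^ (j : ℕ) % 8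

/-- The first covering triple of the face `k` with labels in the multiset with code `n`. -/
def firstCovering (k : Fin 12) (n : ℕ) : Option (Fin 3 → Fin 10) :=
  (coveringTriples k).find? fun t => ∀ i, codeDigit n (t i) ≠ 0

/-- Twelve times the barycentric coordinate `i` of the corner `l` of the face `k` with respect to
the vertices labelled by `t`. -/
def cornerWeight (k : Fin 12) (t : Fin 3 → Fin 10) (i l : Fin 3) : ℕ :=
  (12 * labelDet (Function.update t i (faceCorner k l)) / labelDet t).toNat

/-- The value `f n`. The match makes the kernel evaluate `n` before it unfolds `f`, so that it
recognizes a value of `n` that it has met before and does not repeat the computation. -/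
def applyEvaluated {α : Type*} (f : ℕ → α) (n : ℕ) : α :=
  match n with
  | 0 => f 0
  | n + 1 => f (n + 1)

theorem applyEvaluated_eq {α : Type*} (f : ℕ → α) (n : ℕ) : applyEvaluated f n = f n := by
  cases n <;> rfl

section

variable {R S : Type*} [CommSemiring R] [CommSemiring S]

/-- The recurrence for the simplex splines on the face `k`, with `y` the barycentric coordinates
with respect to that face and `n` the code of the knots. The coordinates may be scaled and may lie
in any commutative semiring: numbers, to compute values, or indeterminates, to compute
polynomials. -/
def localPiece (k : Fin 12) (y : Fin 3 → R) : ℕ → ℕ → R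
  | 0, n => (firstCovering k n).elim 0 fun t => (1728 / (labelDet t).natAbs : ℕ)
  | d + 1, n => (firstCovering k n).elim 0 fun t =>
      ∑ i, (∑ l, cornerWeight k t i l * y l) *
        applyEvaluated (localPiece k y d) (n - 8 ^ (t i : ℕ))

theorem map_localPiece (φ : R →+* S) (k : Fin 12) (y : Fin 3 → R) (d n : ℕ) :
    φ (localPiece k y d n) = localPiece k (φ ∘ y) d n := by
  induction d generalizing n with
  | zero => rcases h : firstCovering k n with _ | t <;> simp [localPiece, h]
  | succ d ih =>
    rcases h : firstCovering k n with _ | t <;> simp [localPiece, applyEvaluated_eq, h, ih]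

end

theorem localPiece_nonneg (k : Fin 12) {y : Fin 3 → ℝ} (hy : ∀ l, 0 ≤ y l) (d n : ℕ) :
    0 ≤ localPiece k y d n := by
  lift y to Fin 3 → NNReal using hy
  exact (map_localPiece NNReal.toRealHom k y d n) ▸ NNReal.coe_nonneg _

theorem mem_coveringTriples {k : Fin 12} {t : Fin 3 → Fin 10} :
    t ∈ coveringTriples k ↔ t 0 < t 1 ∧ t 1 < t 2 ∧ t 2 < 6 ∧ Covers k t := by
  have ht : ![t 0, t 1, t 2] = t := by
    ext i
    fin_cases i <;> rfl
  simp only [coveringTriples, List.mem_filter, List.mem_map, decide_eq_true_eq, ← and_assoc]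
  refine and_congr_left fun _ => and_congr_left fun _ => ⟨?_, fun h => ?_⟩
  · rintro ⟨⟨a, b, c⟩, habc, rfl⟩
    exact mem_triples.1 habc
  · exact ⟨(t 0, t 1, t 2), mem_triples.2 h, ht⟩

theorem strictMono_of_monotone {t : Fin 3 → Fin 10} (ht : Monotone t) (hdet : labelDet t ≠ 0) :
    t 0 < t 1 ∧ t 1 < t 2 := by
  refine ⟨(ht (by decide)).lt_of_ne fun h => hdet ?_, (ht (by decide)).lt_of_ne fun h => hdet ?_⟩
  all_goals
    simp only [labelDet, h]
    ring

theorem codeDigit_code {m : Fin 10 → ℕ} (hm8 : ∀ j, m j < 8) (j : Fin 10) :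
    codeDigit (code m) j = m j := by
  have h (i : Fin 10) := hm8 i
  simp only [Fin.forall_fin_succ, Fin.forall_fin_zero] at h
  simp only [codeDigit, code, Fin.sum_univ_succ, Fin.sum_univ_zero]
  fin_cases j <;> simp <;> simp at h <;> omega

theorem code_tsub_single {m : Fin 10 → ℕ} {j : Fin 10} (hj : m j ≠ 0) :
    code (m - Pi.single j 1) = code m - 8 ^ (j : ℕ) := by
  refine Nat.eq_sub_of_add_eq ?_
  conv_rhs => rw [← tsub_add_cancel_of_le (single_le_of_ne_zero hj)]
  simp [code, add_mul, Finset.sum_add_distrib, Pi.single_apply]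

theorem cornerWeight_mul_labelDet : ∀ k, ∀ t ∈ coveringTriples k, ∀ i l,
    (cornerWeight k t i l : ℤ) * labelDet t =
      12 * labelDet (Function.update t i (faceCorner k l)) := by
  decide +kernel

theorem natAbs_labelDet_dvd : ∀ k, ∀ t ∈ coveringTriples k, (labelDet t).natAbs ∣ 1728 := by
  decide +kernel

theorem firstCovering_code_eq_some {m : Fin 10 → ℕ} (hm8 : ∀ j, m j < 8) {k : Fin 12}
    {t : Fin 3 → Fin 10} (h : firstCovering k (code m) = some t) :
    t ∈ coveringTriples k ∧ ∀ i, m (t i) ≠ 0 := by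
  refine ⟨List.mem_of_find?_eq_some h, ?_⟩
  simpa [codeDigit_code hm8] using List.find?_some h

theorem firstCovering_code_eq_none {m : Fin 10 → ℕ} (hm8 : ∀ j, m j < 8)
    (hm6 : ∀ j, m j ≠ 0 → j < 6) {k : Fin 12} (h : firstCovering k (code m) = none)
    {t : Fin 3 → Fin 10} (ht : Monotone t) (hmt : ∀ i, m (t i) ≠ 0) : ¬Covers k t := by
  intro hk
  obtain ⟨h01, h12⟩ := strictMono_of_monotone ht hk.1
  have := List.find?_eq_none.1 h t (mem_coveringTriples.2 ⟨h01, h12, hm6 _ (hmt 2), hk⟩)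
  simp [codeDigit_code hm8, hmt] at this

section

variable {v : Fin 3 → Plane} (hv : signedArea v ≠ 0) {k : Fin 12} {x : Plane}

include hv

theorem facePiece_eq_zero_of_not_covers {d : ℕ} {m : Fin 10 → ℕ} (hm : ∑ j, m j = d + 3)
    (h : ∀ t, Monotone t → (∀ i, m (t i) ≠ 0) → ¬Covers k t) : facePiece v k d m x = 0 := by
  induction d generalizing m with
  | zero =>
    obtain ⟨t, ht, rfl⟩ := exists_monotone_eq_sum_single hm
    rw [facePiece_zero_sum_single hv,
      if_neg (h t ht fun i => (sum_single_ne_zero_iff t).2 ⟨i, rfl⟩)]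
  | succ d ih =>
    refine Finset.sum_eq_zero fun j _ => ?_
    by_cases hj : m j = 0
    · by_cases h : knotTriple v m = none
      · simp [knotCoeff_eq_zero h]
      · rw [(isAffineRepr_knotCoeff h x).support j hj, zero_mul]
    · rw [ih (sum_tsub_single hm hj) fun t ht hmt => h t ht fun i h0 => hmt i (by simp [h0]),
        mul_zero]

theorem sum_cornerWeight_mul {t : Fin 3 → Fin 10} (ht : t ∈ coveringTriples k) (i : Fin 3) :
    ∑ l, cornerWeight k t i l * bary (vertex v ∘ faceCorner k) x l =
      12 * bary (vertex v ∘ t) x i := by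
  have hk := (signedArea_vertex_ne_zero_iff hv).2 (labelDet_faceCorner_ne_zero k)
  have htdet := (mem_coveringTriples.1 ht).2.2.2.1
  have ht' : (labelDet t : ℝ) ≠ 0 := Int.cast_ne_zero.2 htdet
  conv_rhs => rw [← sum_bary_smul hk x, bary_affineCombination
    ((signedArea_vertex_ne_zero_iff hv).2 htdet) (sum_bary hk x), Finset.mul_sum]
  refine Finset.sum_congr rfl fun l _ => ?_
  have h : (cornerWeight k t i l * labelDet t : ℝ) =
      12 * labelDet (Function.update t i (faceCorner k l)) := by
    exact_mod_cast cornerWeight_mul_labelDet k t ht i l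
  rw [Function.comp_apply, bary_vertex hv, eq_div_of_mul_eq ht' h]
  ring

theorem facePiece_zero_eq {t : Fin 3 → Fin 10} (ht : t ∈ coveringTriples k) {m : Fin 10 → ℕ}
    (hm : ∑ j, m j = 3) (hmt : ∀ i, m (t i) ≠ 0) :
    facePiece v k 0 m x = (1728 / (labelDet t).natAbs : ℕ) := by
  obtain ⟨h01, h12, -, hk⟩ := mem_coveringTriples.1 ht
  obtain ⟨q, hq, rfl⟩ := exists_monotone_eq_sum_single hm
  have hqt : q = t := by
    have hq01 := hq (show (0 : Fin 3) ≤ 1 by decide)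
    have hq12 := hq (show (1 : Fin 3) ≤ 2 by decide)
    have hmem (i : Fin 3) : ∃ l, q l = t i := (sum_single_ne_zero_iff q).1 (hmt i)
    simp only [Fin.exists_fin_succ, Fin.forall_fin_succ, Fin.exists_fin_zero,
      Fin.forall_fin_zero, or_false, and_true] at hmem
    ext i
    fin_cases i <;> simp at hmem ⊢ <;> omega
  rw [facePiece_zero_sum_single hv, hqt, if_pos hk, Nat.cast_div (natAbs_labelDet_dvd k t ht)
    (by exact_mod_cast Int.natAbs_ne_zero.2 hk.1), Nat.cast_natAbs, Int.cast_abs]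
  norm_cast

theorem localPiece_code {s : ℝ} {y : Fin 3 → ℝ}
    (hy : y = s • bary (vertex v ∘ faceCorner k) x) {d : ℕ} {m : Fin 10 → ℕ}
    (hm : ∑ j, m j = d + 3) (hm6 : ∀ j, m j ≠ 0 → j < 6) (hm8 : ∀ j, m j < 8) :
    localPiece k y d (code m) = (12 * s) ^ d * facePiece v k d m x := by
  induction d generalizing m with
  | zero =>
    rcases ht : firstCovering k (code m) with _ | t
    · simp [localPiece, ht, facePiece_eq_zero_of_not_covers hv hm fun _ =>
        firstCovering_code_eq_none hm8 hm6 ht]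
    · obtain ⟨htk, hmt⟩ := firstCovering_code_eq_some hm8 ht
      simp [localPiece, ht, facePiece_zero_eq hv htk hm hmt]
  | succ d ih =>
    rcases ht : firstCovering k (code m) with _ | t
    · simp [localPiece, ht, facePiece_eq_zero_of_not_covers hv hm fun _ =>
        firstCovering_code_eq_none hm8 hm6 ht]
    · obtain ⟨htk, hmt⟩ := firstCovering_code_eq_some hm8 ht
      rw [facePiece_succ_bary hv hm hm6 (mem_coveringTriples.1 htk).2.2.2.1 hmt]
      simp only [localPiece, ht, Option.elim_some, applyEvaluated_eq, Finset.mul_sum]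
      refine Finset.sum_congr rfl fun i _ => ?_
      have hcorner : ∑ l, (cornerWeight k t i l : ℝ) * y l =
          12 * s * bary (vertex v ∘ t) x i := by
        rw [mul_right_comm, ← sum_cornerWeight_mul hv htk i, Finset.sum_mul, hy]
        exact Finset.sum_congr rfl fun l _ => by
          rw [Pi.smul_apply, smul_eq_mul, mul_comm s, mul_assoc]
      rw [hcorner, ← code_tsub_single (hmt i), ih (sum_tsub_single hm (hmt i))
        (fun j hj => hm6 j fun h => hj (by simp [h]))
        fun j => (Nat.sub_le _ _).trans_lt (hm8 j)]
      ring

end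

/-! ### Kronecker substitution -/

theorem coeff_le_eval_one (p : Polynomial ℕ) (n : ℕ) : p.coeff n ≤ p.eval 1 := by
  by_cases hn : n ∈ p.support
  · simpa [Polynomial.eval_eq_sum, Polynomial.sum] using
      Finset.single_le_sum (f := p.coeff) (fun _ _ => Nat.zero_le _) hn
  · simp [Polynomial.notMem_support_iff.1 hn]

theorem eval_eq_coeff_zero_add (p : Polynomial ℕ) (b : ℕ) :
    p.eval b = p.coeff 0 + b * p.divX.eval b := by
  conv_lhs => rw [← p.divX_mul_X_add]
  simp [add_comm, mul_comm]

theorem polynomial_eq_of_eval_eq {p q : Polynomial ℕ} {b : ℕ} (hp : p.eval 1 < b)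
    (hq : q.eval 1 < b) (h : p.eval b = q.eval b) : p = q := by
  ext n
  induction n generalizing p q with
  | zero =>
    have hmod := congrArg (· % b) h
    simp only [eval_eq_coeff_zero_add p b, eval_eq_coeff_zero_add q b,
      Nat.add_mul_mod_self_left] at hmod
    rwa [Nat.mod_eq_of_lt ((coeff_le_eval_one p 0).trans_lt hp),
      Nat.mod_eq_of_lt ((coeff_le_eval_one q 0).trans_lt hq)] at hmod
  | succ n ih =>
    have hdiv := congrArg (· / b) h
    have hb : 0 < b := (Nat.zero_le _).trans_lt hp
    simp only [eval_eq_coeff_zero_add p b, eval_eq_coeff_zero_add q b,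
      Nat.add_mul_div_left _ _ hb] at hdiv
    rw [Nat.div_eq_of_lt ((coeff_le_eval_one p 0).trans_lt hp),
      Nat.div_eq_of_lt ((coeff_le_eval_one q 0).trans_lt hq), zero_add, zero_add] at hdiv
    have hle (r : Polynomial ℕ) : r.divX.eval 1 ≤ r.eval 1 := by
      have := eval_eq_coeff_zero_add r 1
      lia
    simpa using ih ((hle p).trans_lt hp) ((hle q).trans_lt hq) hdiv

/-- The point `b` with the coordinates up to `i` replaced by `1`: the value there of a polynomial
with natural coefficients is the largest digit sum that occurs when the indeterminate `i` is
replaced by a number and all later ones have been. -/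
def onesUpTo {n : ℕ} (b : Fin n → ℕ) (i : Fin n) : Fin n → ℕ := fun j => if i < j then b j else 1

theorem onesUpTo_zero {n : ℕ} (b : Fin (n + 1) → ℕ) :
    onesUpTo b 0 = Fin.cons 1 (Fin.tail b) := by
  ext j
  cases j using Fin.cases <;> simp [onesUpTo, Fin.tail]

theorem onesUpTo_succ {n : ℕ} (b : Fin (n + 1) → ℕ) (i : Fin n) :
    onesUpTo b i.succ = Fin.cons 1 (onesUpTo (Fin.tail b) i) := by
  ext j
  cases j using Fin.cases <;> simp [onesUpTo, Fin.tail]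

theorem eval_coeff_finSuccEquiv_le {n : ℕ} (p : MvPolynomial (Fin (n + 1)) ℕ) (c : Fin n → ℕ)
    (e : ℕ) : MvPolynomial.eval c ((MvPolynomial.finSuccEquiv ℕ n p).coeff e) ≤
      MvPolynomial.eval (Fin.cons 1 c : Fin (n + 1) → ℕ) p := by
  rw [MvPolynomial.eval_eq_eval_mv_eval', ← Polynomial.coeff_map]
  exact coeff_le_eval_one _ e

theorem mvPolynomial_eq_of_eval_eq {n : ℕ} {p q : MvPolynomial (Fin n) ℕ} {b : Fin n → ℕ}
    (hp : ∀ i, MvPolynomial.eval (onesUpTo b i) p < b i)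
    (hq : ∀ i, MvPolynomial.eval (onesUpTo b i) q < b i)
    (h : MvPolynomial.eval b p = MvPolynomial.eval b q) : p = q := by
  induction n with
  | zero =>
    rw [MvPolynomial.eq_C_of_isEmpty p, MvPolynomial.eq_C_of_isEmpty q] at h ⊢
    simpa using h
  | succ n ih =>
    have hp' := hp 0
    have hq' := hq 0
    rw [← Fin.cons_self_tail b] at h
    rw [onesUpTo_zero] at hp' hq'
    rw [MvPolynomial.eval_eq_eval_mv_eval'] at h hp' hq'
    rw [MvPolynomial.eval_eq_eval_mv_eval'] at h
    have hslice := polynomial_eq_of_eval_eq hp' hq' h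
    refine (MvPolynomial.finSuccEquiv ℕ n).injective (Polynomial.ext fun e => ih
      (b := Fin.tail b) (fun i => ?_) (fun i => ?_) ?_)
    · exact (eval_coeff_finSuccEquiv_le p _ e).trans_lt (onesUpTo_succ b i ▸ hp i.succ)
    · exact (eval_coeff_finSuccEquiv_le q _ e).trans_lt (onesUpTo_succ b i ▸ hq i.succ)
    · simpa only [Polynomial.coeff_map] using congrArg (Polynomial.coeff · e) hslice

/-! ### Linear precision -/

instance {P : BasisName → Prop} [DecidablePred P] : Decidable (∀ b, P b) :=
  decidable_of_iff (∀ b ∈ [BasisName.Ba, .Bb, .Bc, .Bd, .Be, .Bf], P b)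
    ⟨fun h b => h b (by cases b <;> simp), fun h b _ => h b⟩

/-- Four times the weight of a basis function, a natural number. -/
def weightNum (e : Entry) : ℕ := (4 * e.2.1).num.toNat

theorem cast_weightNum : ∀ b, ∀ e ∈ entries b, (weightNum e : ℚ) = 4 * e.2.1 := by
  decide +kernel

theorem isSmoothKnots_of_mem : ∀ b, ∀ e ∈ entries b, IsSmoothKnots e.1 := by
  decide +kernel

theorem knots_lt_eight : ∀ b, ∀ e ∈ entries b, ∀ j, e.1 j < 8 := by
  decide +kernel

theorem sum_dual : ∀ b, ∀ e ∈ entries b, ∑ j, e.2.2 j = 5 := by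
  decide +kernel

/-- Sixty times the barycentric coordinates of the domain point with respect to the
macrotriangle. -/
def domainBary (e : Entry) (i : Fin 3) : ℕ := ∑ j, e.2.2 j * (vertexCoord j i).toNat

section

variable {R S : Type*} [CommSemiring R] [CommSemiring S]

/-- The spline on the face `k` whose coefficients are the barycentric coordinates `i` of the domain
points, in the local coordinates `y` and scaled by `4 * 60 * 12 ^ 5`. -/
def baryInterpolant (b : BasisName) (k : Fin 12) (i : Fin 3) (y : Fin 3 → R) : R :=
  ∑ e ∈ entries b, (weightNum e * domainBary e i : ℕ) * localPiece k y 5 (code e.1)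

/-- The barycentric coordinate `i`, in the local coordinates `y` of the face `k`, homogenized and
scaled like `baryInterpolant`. -/
def baryQuintic (k : Fin 12) (i : Fin 3) (y : Fin 3 → R) : R :=
  (20 * 12 ^ 5 : ℕ) * (∑ l, ((vertexCoord (faceCorner k l) i).toNat : R) * y l) * (∑ l, y l) ^ 4

theorem map_baryInterpolant (φ : R →+* S) (b : BasisName) (k : Fin 12) (i : Fin 3)
    (y : Fin 3 → R) : φ (baryInterpolant b k i y) = baryInterpolant b k i (φ ∘ y) := by
  simp only [baryInterpolant, map_sum, map_mul, map_natCast, map_localPiece]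

theorem map_baryQuintic (φ : R →+* S) (k : Fin 12) (i : Fin 3) (y : Fin 3 → R) :
    φ (baryQuintic k i y) = baryQuintic k i (φ ∘ y) := by
  simp only [baryQuintic, map_sum, map_mul, map_pow, map_natCast, Function.comp_apply]

end

/-- The substitution that reduces an identity between quintic polynomials to an identity between
numbers. The entry `r` has to exceed the values of the polynomials at `onesUpTo kroneckerBase r`. -/
def kroneckerBase : Fin 3 → ℕ := ![2 ^ 1536, 2 ^ 256, 2 ^ 40]

theorem baryInterpolant_kronecker : ∀ k, ∀ y ∈ [kroneckerBase, onesUpTo kroneckerBase 0,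
      onesUpTo kroneckerBase 1, onesUpTo kroneckerBase 2],
    ∀ b i, baryInterpolant b k i y = baryQuintic k i y := by
  decide +kernel

theorem baryQuintic_lt_kronecker : ∀ k i r,
    baryQuintic k i (onesUpTo kroneckerBase r) < kroneckerBase r := by
  decide +kernel

theorem baryInterpolant_eq {R : Type*} [CommSemiring R] (b : BasisName) (k : Fin 12) (i : Fin 3)
    (y : Fin 3 → R) : baryInterpolant b k i y = baryQuintic k i y := by
  have hX : baryInterpolant b k i (MvPolynomial.X : Fin 3 → MvPolynomial (Fin 3) ℕ) =
      baryQuintic k i MvPolynomial.X := by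
    have heval (c : Fin 3 → ℕ) : MvPolynomial.eval c ∘ MvPolynomial.X = c :=
      funext fun l => MvPolynomial.eval_X l
    have hlt (r : Fin 3) := baryQuintic_lt_kronecker k i r
    refine mvPolynomial_eq_of_eval_eq (b := kroneckerBase) (fun r => ?_) (fun r => ?_) ?_
    · rw [map_baryInterpolant, heval, baryInterpolant_kronecker]
      · exact hlt r
      · fin_cases r <;> simp
    · rw [map_baryQuintic, heval]
      exact hlt r
    · rw [map_baryInterpolant, map_baryQuintic, heval, baryInterpolant_kronecker]
      simp
  have haeval : (MvPolynomial.aeval (R := ℕ) y).toRingHom ∘ MvPolynomial.X = y :=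
    funext fun l => MvPolynomial.aeval_X y l
  simpa only [map_baryInterpolant, map_baryQuintic, haeval] using
    congrArg (MvPolynomial.aeval (R := ℕ) y).toRingHom hX

theorem toNat_vertexCoord : ∀ j i, ((vertexCoord j i).toNat : ℤ) = vertexCoord j i := by
  decide

theorem sum_dual_div_five {b : BasisName} (s : Index b) : ∑ j, (s.1.2.2 j : ℝ) / 5 = 1 := by
  rw [← Finset.sum_div, ← Nat.cast_sum, sum_dual b s.1 s.2]
  norm_num

theorem domainPoint_eq_sum {b : BasisName} (v : Fin 3 → Plane) (s : Index b) :
    domainPoint b v s = ∑ j, ((s.1.2.2 j : ℝ) / 5) • vertex v j := by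
  simp only [domainPoint, Finset.smul_sum, smul_smul, one_div_mul_eq_div]

section

variable {v : Fin 3 → Plane} (hv : signedArea v ≠ 0) {b : BasisName}

include hv

theorem weightNum_mul_localPiece {k : Fin 12} {x : Plane} (hx : x ∈ face v k) {r : ℝ}
    {y : Fin 3 → ℝ} (hy : y = r • bary (vertex v ∘ faceCorner k) x) (s : Index b) :
    weightNum s.1 * localPiece k y 5 (code s.1.1) = 4 * (12 * r) ^ 5 * basisSpline b v s x := by
  have hs := isSmoothKnots_of_mem b s.1 s.2
  have hw : (weightNum s.1 : ℝ) = 4 * (s.1.2.1 : ℝ) := by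
    exact_mod_cast cast_weightNum b s.1 s.2
  rw [localPiece_code hv hy hs.1 hs.2.1 (knots_lt_eight b s.1 s.2), basisSpline,
    hs.simplexSpline_eq hv hx, hw]
  ring

theorem bary_vertex_self (j : Fin 10) (i : Fin 3) :
    bary v (vertex v j) i = (vertexCoord j i).toNat / 12 := by
  rw [vertex_eq_sum, bary_sum_smul hv]
  · congr 1
    exact_mod_cast (toNat_vertexCoord j i).symm
  · rw [← Finset.sum_div, ← Int.cast_sum, sum_vertexCoord]
    norm_num

theorem bary_domainPoint (s : Index b) (i : Fin 3) :
    bary v (domainPoint b v s) i = domainBary s.1 i / 60 := by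
  simp only [domainPoint_eq_sum, bary_affineCombination hv (sum_dual_div_five s),
    bary_vertex_self hv, domainBary, Nat.cast_sum, Nat.cast_mul, Finset.sum_div]
  exact Finset.sum_congr rfl fun j _ => by ring

theorem sum_bary_domainPoint_mul {x : Plane} (hx : x ∈ triangle v) (i : Fin 3) :
    ∑ s, bary v (domainPoint b v s) i * basisSpline b v s x = bary v x i := by
  obtain ⟨k, hk⟩ := exists_mem_face hv hx
  have hk0 := (signedArea_vertex_ne_zero_iff hv).2 (labelDet_faceCorner_ne_zero k)
  have hleft : baryInterpolant b k i (bary (vertex v ∘ faceCorner k) x) =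
      240 * 12 ^ 5 * ∑ s, bary v (domainPoint b v s) i * basisSpline b v s x := by
    rw [baryInterpolant, ← Finset.sum_coe_sort, Finset.mul_sum]
    refine Finset.sum_congr rfl fun s _ => ?_
    rw [Nat.cast_mul, mul_right_comm, weightNum_mul_localPiece hv hk (one_smul ℝ _).symm,
      bary_domainPoint hv]
    ring
  have hright : baryQuintic k i (bary (vertex v ∘ faceCorner k) x) =
      240 * 12 ^ 5 * bary v x i := by
    conv_rhs => rw [← sum_bary_smul hk0 x, bary_affineCombination hv (sum_bary hk0 x)]
    simp only [baryQuintic, sum_bary hk0, Function.comp_apply, bary_vertex_self hv,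
      Finset.mul_sum, one_pow, mul_one]
    exact Finset.sum_congr rfl fun l _ => by ring
  exact mul_left_cancel₀ (by norm_num)
    (hleft.symm.trans ((baryInterpolant_eq b k i _).trans hright))

theorem sum_basisSpline {x : Plane} (hx : x ∈ triangle v) : ∑ s, basisSpline b v s x = 1 := by
  rw [← sum_bary hv x, ← Finset.sum_congr rfl fun i _ => sum_bary_domainPoint_mul (b := b) hv hx i,
    Finset.sum_comm]
  simp only [← Finset.sum_mul, sum_bary hv, one_mul]

theorem basisSpline_nonneg (s : Index b) {x : Plane} (hx : x ∈ triangle v) :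
    0 ≤ basisSpline b v s x := by
  obtain ⟨k, hk⟩ := exists_mem_face hv hx
  have h := weightNum_mul_localPiece hv hk (one_smul ℝ _).symm s
  have hy := (mem_convexHull_range_iff ((signedArea_vertex_ne_zero_iff hv).2
    (labelDet_faceCorner_ne_zero k))).1 (face_eq v k ▸ hk)
  refine nonneg_of_mul_nonneg_right (h ▸ ?_) (by norm_num : (0 : ℝ) < 4 * (12 * 1) ^ 5)
  exact mul_nonneg (Nat.cast_nonneg _) (localPiece_nonneg k hy 5 _)

end

/-! ### Elimination modulo a prime -/

/-- Gaussian elimination modulo `p` on rows with `n` entries: whether the rows have rank `n`. The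
pivot row stays and becomes a row of zeros. -/
def hasFullRank (p : ℕ) : ℕ → List (List ℕ) → Bool
  | 0, _ => true
  | n + 1, rows =>
    (rows.find? fun r => r.headI % p ≠ 0).elim false fun r =>
      hasFullRank p n (rows.map fun q =>
        List.zipWith (fun a c => (r.headI * a + (p - 1) * q.headI * c) % p) q.tail r.tail)

/-- The scalar product of a row with a vector modulo `p`. -/
def rowDot {p : ℕ} (r : List ℕ) (x : List (ZMod p)) : ZMod p :=
  (List.zipWith (fun (a : ℕ) (c : ZMod p) => a * c) r x).sum

theorem rowDot_eq_zero {p : ℕ} {r : List ℕ} {x : List (ZMod p)} (hx : ∀ c ∈ x, c = 0) :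
    rowDot r x = 0 := by
  refine List.sum_eq_zero fun a ha => ?_
  rw [← List.map_uncurry_zip_eq_zipWith, List.mem_map] at ha
  obtain ⟨⟨n, c⟩, hc, rfl⟩ := ha
  simp [hx c (List.of_mem_zip hc).2]

theorem rowDot_zipWith {p : ℕ} (α β : ℕ) {q r : List ℕ} {x : List (ZMod p)}
    (hq : q.length = x.length) (hr : r.length = x.length) :
    rowDot (List.zipWith (fun a c => (α * a + β * c) % p) q r) x =
      α * rowDot q x + β * rowDot r x := by
  induction x generalizing q r with
  | nil => simp [rowDot]
  | cons c x ih =>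
    obtain ⟨a, q, rfl⟩ := List.exists_cons_of_length_eq_add_one hq
    obtain ⟨a', r, rfl⟩ := List.exists_cons_of_length_eq_add_one hr
    have h := ih (q := q) (r := r) (by simpa using hq) (by simpa using hr)
    simp only [rowDot, List.zipWith_cons_cons, List.sum_cons, ZMod.natCast_mod, Nat.cast_add,
      Nat.cast_mul] at h ⊢
    rw [h]
    ring

theorem eq_zero_of_hasFullRank {p : ℕ} [Fact p.Prime] {rows : List (List ℕ)} {x : List (ZMod p)}
    (hrank : hasFullRank p x.length rows) (hlength : ∀ r ∈ rows, r.length = x.length)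
    (hdot : ∀ r ∈ rows, rowDot r x = 0) : ∀ c ∈ x, c = 0 := by
  induction x generalizing rows with
  | nil => simp
  | cons c x ih =>
    rcases hfind : rows.find? fun r => r.headI % p ≠ 0 with _ | pivot
    · simp only [hasFullRank, List.length_cons, hfind, Option.elim_none,
        Bool.false_eq_true] at hrank
    have hpivot := List.mem_of_find?_eq_some hfind
    have hcons (q) (hq : q ∈ rows) :
        q.tail.length = x.length ∧ (q.headI : ZMod p) * c + rowDot q.tail x = 0 := by
      obtain ⟨a, q, rfl⟩ := List.exists_cons_of_length_eq_add_one (hlength q hq)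
      exact ⟨by simpa using hlength _ hq, by simpa [rowDot] using hdot _ hq⟩
    have hx : ∀ a ∈ x, a = 0 := by
      simp only [hasFullRank, List.length_cons, hfind, Option.elim_some] at hrank
      refine ih hrank (fun r hr => ?_) fun r hr => ?_
      all_goals obtain ⟨q, hq, rfl⟩ := List.mem_map.1 hr
      · simp [(hcons q hq).1, (hcons pivot hpivot).1]
      · rw [rowDot_zipWith _ _ (hcons q hq).1 (hcons pivot hpivot).1]
        have hp : ((p - 1 : ℕ) : ZMod p) = -1 := by
          rw [Nat.cast_sub (Fact.out : p.Prime).one_le]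
          simp
        push_cast [hp]
        linear_combination (pivot.headI : ZMod p) * (hcons q hq).2 -
          (q.headI : ZMod p) * (hcons pivot hpivot).2
    refine List.forall_mem_cons.2 ⟨?_, hx⟩
    have hne : (pivot.headI : ZMod p) ≠ 0 := by
      have h := List.find?_some hfind
      rwa [decide_eq_true_eq, ne_eq, ← Nat.dvd_iff_mod_eq_zero, ← ZMod.natCast_eq_zero_iff] at h
    simpa [rowDot_eq_zero hx, hne] using (hcons pivot hpivot).2

theorem det_map_natCast {n R : Type*} [Fintype n] [DecidableEq n] [CommRing R]
    (N : Matrix n n ℕ) :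
    (N.map (Nat.cast : ℕ → R)).det = ((N.map (Nat.cast : ℕ → ℤ)).det : R) := by
  rw [Int.cast_det, Matrix.map_map]
  congr 2
  exact funext fun a => (Int.cast_natCast a).symm

theorem det_map_natCast_ne_zero {n R S : Type*} [Fintype n] [DecidableEq n] [CommRing R]
    [CharZero R] [CommRing S] {N : Matrix n n ℕ} (h : (N.map (Nat.cast : ℕ → S)).det ≠ 0) :
    (N.map (Nat.cast : ℕ → R)).det ≠ 0 := by
  rw [det_map_natCast] at h ⊢
  exact fun h0 => h (by rw [Int.cast_eq_zero.1 h0, Int.cast_zero])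

theorem det_ne_zero_of_hasFullRank {α : Type*} [DecidableEq α] {s : Finset α} {l : List α}
    (hl : l.Nodup) (hs : l.toFinset = s) {f : α → α → ℕ} {p : ℕ} [Fact p.Prime]
    (hrank : hasFullRank p l.length (l.map fun a => l.map (f a))) :
    ((Matrix.of fun i j : s => f i j).map (Nat.cast : ℕ → ZMod p)).det ≠ 0 := by
  intro hdet
  obtain ⟨x, hx0, hx⟩ := Matrix.exists_mulVec_eq_zero_iff.2 hdet
  let y (a : α) : ZMod p := if h : a ∈ s then x ⟨a, h⟩ else 0
  have hy (a : s) : y a = x a := dif_pos a.2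
  have hdot (a) (ha : a ∈ l) : rowDot (l.map (f a)) (l.map y) = 0 := by
    rw [rowDot, List.zipWith_map, List.zipWith_self, ← List.sum_toFinset _ hl, hs,
      ← Finset.sum_coe_sort]
    simp only [hy]
    exact congrFun hx ⟨a, hs ▸ List.mem_toFinset.2 ha⟩
  have hzero := eq_zero_of_hasFullRank (x := l.map y) (by rwa [List.length_map])
    (by simp) (by simpa using hdot)
  refine hx0 (funext fun a => (hy a).symm.trans (hzero _ ?_))
  exact List.mem_map_of_mem (List.mem_toFinset.1 (hs ▸ a.2))

/-! ### Nonsingularity of the collocation matrices -/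

/-- The six permutations of the corners, as a list. -/
def permutations : List (Equiv.Perm (Fin 3)) :=
  [1, Equiv.swap 0 1, Equiv.swap 0 2, Equiv.swap 1 2, Equiv.swap 0 1 * Equiv.swap 1 2,
    Equiv.swap 1 2 * Equiv.swap 0 1]

theorem mem_permutations : ∀ σ, σ ∈ permutations := by
  decide

/-- The members of a basis, as a list. -/
def members (b : BasisName) : List Entry :=
  ((representatives b).flatMap fun e =>
    permutations.map fun σ => (permute σ e.1, e.2.1, permute σ e.2.2)).dedup

theorem toFinset_members (b : BasisName) : (members b).toFinset = entries b := by
  ext e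
  simp only [members, entries, List.mem_toFinset, List.mem_dedup, List.mem_flatMap, List.mem_map,
    Finset.mem_image, Finset.mem_product, Finset.mem_univ, true_and]
  exact ⟨fun ⟨a, ha, σ, _, h⟩ => ⟨(σ, a), ha, h⟩,
    fun ⟨a, ha, h⟩ => ⟨a.2, ha, a.1, mem_permutations a.1, h⟩⟩

theorem nodup_members (b : BasisName) : (members b).Nodup := List.nodup_dedup _

theorem length_members (b : BasisName) : (members b).length = 39 := by
  rw [← List.toFinset_card_of_nodup (nodup_members b), toFinset_members, card_entries]

/-- The barycentric coordinate `l` of the domain point with respect to the face `k`, scaled by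
`5 * labelDet (faceCorner k) ^ 2`. -/
def domainCoord (k : Fin 12) (e : Entry) (l : Fin 3) : ℤ :=
  (∑ j, e.2.2 j * labelDet (Function.update (faceCorner k) l j)) * labelDet (faceCorner k)

/-- The first face that contains the domain point. -/
def domainFace (e : Entry) : Option (Fin 12) :=
  (List.finRange 12).find? fun k => ∀ l, 0 ≤ domainCoord k e l

theorem isSome_domainFace : ∀ b, ∀ e ∈ entries b, (domainFace e).isSome := by
  decide +kernel

/-- The value of the basis function `e'` at the domain point of `e`, scaled by a factor that does
not depend on `e'`. -/
def collocationNum (e e' : Entry) : ℕ :=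
  (domainFace e).elim 0 fun k =>
    applyEvaluated (fun y₀ => applyEvaluated (fun y₁ => applyEvaluated (fun y₂ =>
      weightNum e' * applyEvaluated (localPiece k ![y₀, y₁, y₂] 5) (code e'.1))
        (domainCoord k e 2).toNat) (domainCoord k e 1).toNat) (domainCoord k e 0).toNat

/-- Any prime that divides none of the six determinants would do in place of `17`. -/
theorem hasFullRank_collocationNum : ∀ b,
    hasFullRank 17 39 ((members b).map fun e => (members b).map (collocationNum e)) := by
  decide +kernel

/-- The factor by which `collocationNum` exceeds the value of the basis function. -/
noncomputable def collocationScale (e : Entry) : ℝ :=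
  (domainFace e).elim 0 fun k => 4 * (12 * (5 * labelDet (faceCorner k) ^ 2)) ^ 5

theorem collocationScale_ne_zero {b : BasisName} (s : Index b) : collocationScale s.1 ≠ 0 := by
  obtain ⟨k, hk⟩ := Option.isSome_iff_exists.1 (isSome_domainFace b s.1 s.2)
  have hdet : (labelDet (faceCorner k) : ℝ) ≠ 0 :=
    Int.cast_ne_zero.2 (labelDet_faceCorner_ne_zero k)
  rw [collocationScale, hk, Option.elim_some]
  positivity

theorem domainCoord_nonneg {e : Entry} {k : Fin 12} (h : domainFace e = some k) (l : Fin 3) :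
    0 ≤ domainCoord k e l :=
  of_decide_eq_true (p := ∀ l, 0 ≤ domainCoord k e l)
    (List.find?_some (p := fun k => ∀ l, 0 ≤ domainCoord k e l) h) l

section

variable {v : Fin 3 → Plane} (hv : signedArea v ≠ 0) {b : BasisName} (s : Index b)

include hv

theorem domainCoord_eq (k : Fin 12) (l : Fin 3) : (domainCoord k s.1 l : ℝ) =
    5 * (labelDet (faceCorner k) : ℝ) ^ 2 *
      bary (vertex v ∘ faceCorner k) (domainPoint b v s) l := by
  have hdet : (labelDet (faceCorner k) : ℝ) ≠ 0 :=
    Int.cast_ne_zero.2 (labelDet_faceCorner_ne_zero k)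
  rw [domainPoint_eq_sum, bary_affineCombination ((signedArea_vertex_ne_zero_iff hv).2
    (labelDet_faceCorner_ne_zero k)) (sum_dual_div_five s), domainCoord, Finset.mul_sum]
  push_cast
  rw [Finset.sum_mul]
  refine Finset.sum_congr rfl fun j _ => ?_
  rw [bary_vertex hv]
  field_simp

theorem domainPoint_mem_face {k : Fin 12} (hk : domainFace s.1 = some k) :
    domainPoint b v s ∈ face v k := by
  rw [face_eq, mem_convexHull_range_iff ((signedArea_vertex_ne_zero_iff hv).2
    (labelDet_faceCorner_ne_zero k))]
  intro l
  have hdet : (labelDet (faceCorner k) : ℝ) ≠ 0 :=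
    Int.cast_ne_zero.2 (labelDet_faceCorner_ne_zero k)
  have hcoord : (0 : ℝ) ≤ domainCoord k s.1 l := Int.cast_nonneg (domainCoord_nonneg hk l)
  rw [domainCoord_eq hv] at hcoord
  exact nonneg_of_mul_nonneg_right hcoord (by positivity)

theorem collocationNum_eq (t : Index b) :
    (collocationNum s.1 t.1 : ℝ) = collocationScale s.1 * collocation b v s t := by
  obtain ⟨k, hk⟩ := Option.isSome_iff_exists.1 (isSome_domainFace b s.1 s.2)
  let y (l : Fin 3) : ℕ := (domainCoord k s.1 l).toNat
  have hy : Nat.castRingHom ℝ ∘ y =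
      (5 * (labelDet (faceCorner k) : ℝ) ^ 2) •
        bary (vertex v ∘ faceCorner k) (domainPoint b v s) := by
    ext l
    rw [Pi.smul_apply, smul_eq_mul, ← domainCoord_eq hv s k l, Function.comp_apply, eq_natCast]
    exact_mod_cast Int.toNat_of_nonneg (domainCoord_nonneg hk l)
  have hvec : ![y 0, y 1, y 2] = y := by
    ext l
    fin_cases l <;> rfl
  simp only [collocationNum, collocationScale, hk, Option.elim_some, applyEvaluated_eq, collocation,
    Matrix.of_apply]
  rw [hvec, Nat.cast_mul, ← Nat.coe_castRingHom, map_localPiece]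
  exact weightNum_mul_localPiece hv (domainPoint_mem_face hv s hk) hy t

end

theorem collocation_congr {v w : Fin 3 → Plane} (hv : signedArea v ≠ 0) (hw : signedArea w ≠ 0)
    (b : BasisName) : collocation b v = collocation b w := by
  ext s t
  refine mul_left_cancel₀ (collocationScale_ne_zero s) ?_
  rw [← collocationNum_eq hv, ← collocationNum_eq hw]

theorem det_collocation_ne_zero {v : Fin 3 → Plane} (hv : signedArea v ≠ 0) (b : BasisName) :
    (collocation b v).det ≠ 0 := by
  have : Fact (Nat.Prime 17) := ⟨by norm_num⟩
  have hrank := length_members b ▸ hasFullRank_collocationNum b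
  have h := det_map_natCast_ne_zero (R := ℝ)
    (det_ne_zero_of_hasFullRank (nodup_members b) (toFinset_members b) hrank)
  have hmul : (Matrix.of fun s t : Index b => collocationNum s t).map (Nat.cast : ℕ → ℝ) =
      Matrix.diagonal (fun s : Index b => collocationScale s.1) * collocation b v := by
    ext s t
    rw [Matrix.diagonal_mul]
    exact collocationNum_eq hv s t
  rw [hmul, Matrix.det_mul] at h
  exact right_ne_zero_of_mul h

/-! ### Stability -/

theorem enorm_le_eLpNorm_top_of_continuousOn {X E : Type*} [TopologicalSpace X]
    [MeasurableSpace X] [OpensMeasurableSpace X] [NormedAddCommGroup E] {μ : Measure X}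
    [μ.IsOpenPosMeasure] {s : Set X} {f : X → E} (hf : ContinuousOn f s) {x : X} (hx : x ∈ s)
    (hxs : x ∈ closure (interior s)) : ‖f x‖ₑ ≤ eLpNorm f ⊤ (μ.restrict s) := by
  set C := eLpNorm f ⊤ (μ.restrict s) with hC
  have hae : ∀ᵐ y ∂μ.restrict s, ‖f y‖ₑ ≤ C := by
    rw [hC, eLpNorm_exponent_top]
    exact ae_le_eLpNormEssSup
  have hdense : Dense {y | y ∈ interior s → ‖f y‖ₑ ≤ C} :=
    Measure.dense_of_ae ((ae_restrict_iff' isOpen_interior.measurableSet).1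
      (ae_restrict_of_ae_restrict_of_subset interior_subset hae))
  have hxt := closure_minimal (hdense.open_subset_closure_inter isOpen_interior)
    isClosed_closure hxs
  have := mem_closure_iff_nhdsWithin_neBot.1 hxt
  have hfx := ((hf x hx).mono (Set.inter_subset_left.trans interior_subset :
    interior s ∩ {y | y ∈ interior s → ‖f y‖ₑ ≤ C} ⊆ s)).enorm
  exact le_of_tendsto hfx (eventually_mem_nhdsWithin.mono fun y hy => hy.2 hy.1)

theorem isCompact_triangle (v : Fin 3 → Plane) : IsCompact (triangle v) :=
  (Set.finite_range v).isCompact_convexHull ℝ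

theorem convex_triangle (v : Fin 3 → Plane) : Convex ℝ (triangle v) := convex_convexHull ℝ _

theorem domainPoint_mem_triangle {b : BasisName} (v : Fin 3 → Plane) (s : Index b) :
    domainPoint b v s ∈ triangle v := by
  rw [domainPoint_eq_sum]
  exact (convex_triangle v).sum_mem (fun _ _ => by positivity) (sum_dual_div_five s)
    fun j _ => vertex_mem_triangle v j

section

variable {v : Fin 3 → Plane} (hv : AffineIndependent ℝ v)

include hv

theorem interior_triangle_nonempty : (interior (triangle v)).Nonempty := by
  rw [triangle, interior_convexHull_nonempty_iff_affineSpan_eq_top,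
    hv.affineSpan_eq_top_iff_card_eq_finrank_add_one]
  simp

theorem uniqueDiffOn_triangle : UniqueDiffOn ℝ (triangle v) :=
  uniqueDiffOn_convex (convex_triangle v) (interior_triangle_nonempty hv)

theorem ofReal_norm_le_eLpNorm_triangle {f : Plane → ℝ} (hf : ContinuousOn f (triangle v))
    {x : Plane} (hx : x ∈ triangle v) :
    ENNReal.ofReal ‖f x‖ ≤ eLpNorm f ⊤ (volume.restrict (triangle v)) := by
  rw [ofReal_norm]
  refine enorm_le_eLpNorm_top_of_continuousOn hf hx ?_
  rw [(convex_triangle v).closure_interior_eq_closure_of_nonempty_interior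
    (interior_triangle_nonempty hv)]
  exact subset_closure hx

end

theorem eLpNorm_triangle_le {v : Fin 3 → Plane} {f : Plane → ℝ} {C : ℝ}
    (h : ∀ x ∈ triangle v, ‖f x‖ ≤ C) :
    eLpNorm f ⊤ (volume.restrict (triangle v)) ≤ ENNReal.ofReal C := by
  rw [eLpNorm_exponent_top]
  exact eLpNormEssSup_le_of_ae_bound
    (ae_restrict_of_forall_mem (isCompact_triangle v).measurableSet h)

theorem collocation_mulVec (b : BasisName) (v : Fin 3 → Plane) (c : Index b → ℝ) :
    (collocation b v).mulVec c = fun s => spline b v c (domainPoint b v s) :=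
  funext fun s => by
    simp only [Matrix.mulVec, dotProduct, spline, collocation, Matrix.of_apply, mul_comm]

section

variable {v : Fin 3 → Plane} (hv : AffineIndependent ℝ v) (b : BasisName) (c : Index b → ℝ)

include hv

theorem spline_mem_splineSpace : spline b v c ∈ splineSpace v := by
  have hmem (s : Index b) := (isSmoothKnots_of_mem b s.1 s.2).simplexSpline_mem_splineSpace
    (signedArea_ne_zero hv)
  refine ⟨ContDiffOn.sum fun s _ => contDiffOn_const.mul (contDiffOn_const.mul (hmem s).1),
    fun k => ?_⟩
  choose p hp hpx using fun s => (hmem s).2 k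
  refine ⟨∑ s, (c s * (s.1.2.1 : ℝ)) • p s, ?_, fun x hx => ?_⟩
  · exact MvPolynomial.totalDegree_finsetSum_le fun s _ =>
      (MvPolynomial.totalDegree_smul_le _ _).trans (hp s)
  · simp only [spline, basisSpline, map_sum, MvPolynomial.smul_eval, mul_assoc, hpx _ x hx]

theorem norm_spline_le {x : Plane} (hx : x ∈ triangle v) : ‖spline b v c x‖ ≤ ‖c‖ := by
  have hv' := signedArea_ne_zero hv
  calc ‖spline b v c x‖ ≤ ∑ s, ‖c s * basisSpline b v s x‖ := norm_sum_le _ _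
    _ ≤ ∑ s, ‖c‖ * basisSpline b v s x := by
        refine Finset.sum_le_sum fun s _ => ?_
        have hs := basisSpline_nonneg hv' s hx
        rw [norm_mul, Real.norm_of_nonneg hs]
        exact mul_le_mul_of_nonneg_right (norm_le_pi_norm c s) hs
    _ = ‖c‖ := by rw [← Finset.mul_sum, sum_basisSpline hv' hx, mul_one]

theorem isUnit_det_collocation : IsUnit (collocation b v).det :=
  (det_collocation_ne_zero (signedArea_ne_zero hv) b).isUnit

theorem norm_le_norm_inv_collocation_mul :
    ‖c‖ ≤ ‖(collocation b v)⁻¹‖ * ‖fun s => spline b v c (domainPoint b v s)‖ := by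
  have hc : c = (collocation b v)⁻¹.mulVec ((collocation b v).mulVec c) := by
    rw [Matrix.mulVec_mulVec, Matrix.nonsing_inv_mul _ (isUnit_det_collocation hv b),
      Matrix.one_mulVec]
  conv_lhs => rw [hc]
  rw [← collocation_mulVec]
  exact Matrix.linfty_opNorm_mulVec _ _

theorem norm_inv_collocation_pos : 0 < ‖(collocation b v)⁻¹‖ := by
  have : Nonempty (Index b) := by
    rw [← Fintype.card_pos_iff, Fintype.card_coe, card_entries]
    norm_num
  refine norm_pos_iff.2 fun h => ?_
  have hone := Matrix.mul_nonsing_inv _ (isUnit_det_collocation hv b)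
  rw [h, mul_zero] at hone
  exact zero_ne_one hone

theorem isStabilityConstant_norm_inv_collocation :
    IsStabilityConstant b ‖(collocation b v)⁻¹‖ := by
  refine ⟨norm_inv_collocation_pos hv b, fun w hw c => ?_⟩
  have hupper := eLpNorm_triangle_le fun x hx => norm_spline_le hw b c hx
  refine ⟨?_, hupper⟩
  have hcont := (spline_mem_splineSpace hw b c).1.continuousOn
  have hfin := ne_top_of_le_ne_top ENNReal.ofReal_ne_top hupper
  rw [ENNReal.ofReal_le_iff_le_toReal hfin, inv_mul_le_iff₀ (norm_inv_collocation_pos hv b),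
    collocation_congr (signedArea_ne_zero hv) (signedArea_ne_zero hw)]
  refine (norm_le_norm_inv_collocation_mul hw b c).trans ?_
  gcongr
  refine (pi_norm_le_iff_of_nonneg ENNReal.toReal_nonneg).2 fun s => ?_
  exact (ENNReal.ofReal_le_iff_le_toReal hfin).1
    (ofReal_norm_le_eLpNorm_triangle hw hcont (domainPoint_mem_triangle w s))

end

/-! ### Distance of the coefficients from the values at the domain points -/

theorem norm_sub_sub_fderivWithin_le {E F : Type*} [NormedAddCommGroup E] [NormedSpace ℝ E]
    [NormedAddCommGroup F] [NormedSpace ℝ F] {s : Set E} {f : E → F} {C h : ℝ} {x y : E}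
    (hs : Convex ℝ s) (hus : UniqueDiffOn ℝ s) (hf : ContDiffOn ℝ 2 f s)
    (hC : ∀ z ∈ s, ‖fderivWithin ℝ (fderivWithin ℝ f s) s z‖ ≤ C)
    (hh : ∀ z ∈ s, ‖z - x‖ ≤ h) (hx : x ∈ s) (hy : y ∈ s) :
    ‖f y - f x - fderivWithin ℝ f s x (y - x)‖ ≤ C * h ^ 2 := by
  have hC0 : 0 ≤ C := (norm_nonneg (fderivWithin ℝ (fderivWithin ℝ f s) s x)).trans (hC x hx)
  have hh0 : 0 ≤ h := (norm_nonneg _).trans (hh x hx)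
  have hf' : DifferentiableOn ℝ (fderivWithin ℝ f s) s :=
    (hf.fderivWithin hus (m := 1) (by norm_num)).differentiableOn one_ne_zero
  have hfderiv (z : E) (hz : z ∈ s) : ‖fderivWithin ℝ f s z - fderivWithin ℝ f s x‖ ≤ C * h :=
    (hs.norm_image_sub_le_of_norm_fderivWithin_le hf' hC hx hz).trans
      (mul_le_mul_of_nonneg_left (hh z hz) hC0)
  calc ‖f y - f x - fderivWithin ℝ f s x (y - x)‖ ≤ C * h * ‖y - x‖ :=
        hs.norm_image_sub_le_of_norm_fderivWithin_le' (hf.differentiableOn two_ne_zero) hfderiv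
          hx hy
    _ ≤ C * h * h := mul_le_mul_of_nonneg_left (hh y hy) (mul_nonneg hC0 hh0)
    _ = C * h ^ 2 := by ring

theorem sum_norm_row_le_linfty_opNorm {m n : Type*} [Fintype m] [Fintype n] (A : Matrix m n ℝ)
    (i : m) : ∑ j, ‖A i j‖ ≤ ‖A‖ := by
  rw [Matrix.linfty_opNorm_def]
  simpa using NNReal.coe_le_coe.2
    (Finset.le_sup (f := fun i => ∑ j, ‖A i j‖₊) (Finset.mem_univ i))

theorem opNorm_bilin_le_card_mul_linfty_opNorm {ι : Type*} [Fintype ι] [DecidableEq ι]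
    (B : EuclideanSpace ℝ ι →L[ℝ] EuclideanSpace ℝ ι →L[ℝ] ℝ) :
    ‖B‖ ≤ Fintype.card ι *
      ‖Matrix.of fun i j => B (EuclideanSpace.single i 1) (EuclideanSpace.single j 1)‖ := by
  set A := Matrix.of fun i j => B (EuclideanSpace.single i 1) (EuclideanSpace.single j 1)
  have hexpand (x y : EuclideanSpace ℝ ι) : B x y = ∑ i, ∑ j, x i * (y j * A i j) := by
    have hsum (x : EuclideanSpace ℝ ι) : ∑ i, x i • EuclideanSpace.single i (1 : ℝ) = x := by
      simpa using (EuclideanSpace.basisFun ι ℝ).sum_repr x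
    conv_lhs => rw [← hsum x, ← hsum y]
    simp only [map_sum, map_smul, sum_apply, smul_apply, smul_eq_mul, Finset.mul_sum]
    rw [Finset.sum_comm]
    exact Finset.sum_congr rfl fun i _ => Finset.sum_congr rfl fun j _ => mul_left_comm _ _ _
  refine ContinuousLinearMap.opNorm_le_bound₂ B (by positivity) fun x y => ?_
  have hentry (i j : ι) : ‖x i * (y j * A i j)‖ ≤ ‖x‖ * ‖y‖ * ‖A i j‖ := by
    rw [norm_mul, norm_mul, mul_assoc]
    gcongr <;> exact PiLp.norm_apply_le _ _
  calc ‖B x y‖ ≤ ∑ i, ∑ j, ‖x i * (y j * A i j)‖ := by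
        rw [hexpand]
        exact (norm_sum_le _ _).trans (Finset.sum_le_sum fun i _ => norm_sum_le _ _)
    _ ≤ ∑ _i : ι, ‖x‖ * ‖y‖ * ‖A‖ := by
        refine Finset.sum_le_sum fun i _ => (Finset.sum_le_sum fun j _ => hentry i j).trans ?_
        rw [← Finset.mul_sum]
        exact mul_le_mul_of_nonneg_left (sum_norm_row_le_linfty_opNorm A i) (by positivity)
    _ = Fintype.card ι * ‖A‖ * ‖x‖ * ‖y‖ := by
        rw [Finset.sum_const, Finset.card_univ, nsmul_eq_mul]
        ring

theorem dist_le_longestEdge {v : Fin 3 → Plane} {x y : Plane} (hx : x ∈ triangle v)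
    (hy : y ∈ triangle v) : dist x y ≤ longestEdge v := by
  obtain ⟨_, ⟨i, rfl⟩, _, ⟨j, rfl⟩, hxy⟩ := convexHull_exists_dist_ge2 hx hy
  refine hxy.trans ?_
  have h01 : dist (v 0) (v 1) ≤ longestEdge v := (le_max_left _ _).trans (le_max_left _ _)
  have h12 : dist (v 1) (v 2) ≤ longestEdge v := (le_max_right _ _).trans (le_max_left _ _)
  have h02 : dist (v 0) (v 2) ≤ longestEdge v := le_max_right _ _
  have h0 : 0 ≤ longestEdge v := dist_nonneg.trans h01
  fin_cases i <;> fin_cases j <;> simp only [Fin.zero_eta, Fin.mk_one, Fin.reduceFinMk, dist_self,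
    h0, h01, h12, h02, dist_comm (v 1) (v 0), dist_comm (v 2) (v 1), dist_comm (v 2) (v 0)]

section

variable {v : Fin 3 → Plane} (hv : AffineIndependent ℝ v)

include hv

theorem exists_isGreatest_norm_hessian {f : Plane → ℝ} (hf : ContDiffOn ℝ 2 f (triangle v)) :
    ∃ H, IsGreatest ((fun x => ‖hessian v f x‖) '' triangle v) H := by
  have hD : ContinuousOn (iteratedFDerivWithin ℝ 2 f (triangle v)) (triangle v) :=
    hf.continuousOn_iteratedFDerivWithin le_rfl (uniqueDiffOn_triangle hv)
  have hcont : ContinuousOn (hessian v f) (triangle v) :=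
    continuousOn_pi.2 fun i => continuousOn_pi.2 fun j =>
      (ContinuousMultilinearMap.apply ℝ (fun _ : Fin 2 => Plane) ℝ
        ![EuclideanSpace.single i 1, EuclideanSpace.single j 1]).continuous.comp_continuousOn hD
  exact ((isCompact_triangle v).image_of_continuousOn hcont.norm).exists_isGreatest
    (.image _ ((interior_triangle_nonempty hv).mono interior_subset))

theorem norm_fderivWithin_fderivWithin_le_hessian (f : Plane → ℝ) {x : Plane}
    (hx : x ∈ triangle v) :
    ‖fderivWithin ℝ (fderivWithin ℝ f (triangle v)) (triangle v) x‖ ≤ 2 * ‖hessian v f x‖ := by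
  refine (opNorm_bilin_le_card_mul_linfty_opNorm _).trans_eq ?_
  simp only [hessian, Fintype.card_fin, Nat.cast_ofNat,
    iteratedFDerivWithin_two_apply' f (uniqueDiffOn_triangle hv) hx]

theorem sum_basisSpline_smul_domainPoint (b : BasisName) {x : Plane} (hx : x ∈ triangle v) :
    ∑ s, basisSpline b v s x • domainPoint b v s = x := by
  have hv' := signedArea_ne_zero hv
  calc ∑ s, basisSpline b v s x • domainPoint b v s
      = ∑ s, basisSpline b v s x • ∑ i, bary v (domainPoint b v s) i • v i := by
        simp only [sum_bary_smul hv']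
    _ = ∑ i, (∑ s, bary v (domainPoint b v s) i * basisSpline b v s x) • v i := by
        simp only [Finset.smul_sum, Finset.sum_smul, smul_smul, mul_comm (basisSpline _ _ _ _)]
        exact Finset.sum_comm
    _ = x := by simp only [sum_bary_domainPoint_mul hv' hx, sum_bary_smul hv']

theorem spline_affine (b : BasisName) (L : Plane →ₗ[ℝ] ℝ) (a : ℝ) (y : Plane) {x : Plane}
    (hx : x ∈ triangle v) :
    spline b v (fun s => a + L (domainPoint b v s - y)) x = a + L (x - y) := by
  have hL : ∑ s, basisSpline b v s x * L (domainPoint b v s) = L x := by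
    conv_rhs => rw [← sum_basisSpline_smul_domainPoint hv b hx]
    simp only [map_sum, map_smul, smul_eq_mul]
  simp only [spline, map_sub, mul_comm _ (basisSpline _ _ _ _), mul_add, mul_sub,
    Finset.sum_add_distrib, Finset.sum_sub_distrib, hL, ← Finset.sum_mul,
    sum_basisSpline (signedArea_ne_zero hv) hx, one_mul]

theorem norm_spline_sub_tangent_le {b : BasisName} (c : Index b → ℝ) {H : ℝ}
    (hH : ∀ x ∈ triangle v, ‖hessian v (spline b v c) x‖ ≤ H) {x y : Plane}
    (hx : x ∈ triangle v) (hy : y ∈ triangle v) :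
    ‖spline b v (c - fun s => spline b v c y +
      fderivWithin ℝ (spline b v c) (triangle v) y (domainPoint b v s - y)) x‖ ≤
      2 * H * longestEdge v ^ 2 := by
  set f := spline b v c with hf
  set φ := fderivWithin ℝ f (triangle v) y
  have hsub : spline b v (c - fun s => f y + φ (domainPoint b v s - y)) x =
      f x - f y - φ (x - y) := by
    rw [sub_sub, ← φ.coe_coe, ← spline_affine hv b (φ : Plane →ₗ[ℝ] ℝ) (f y) y hx]
    simp only [hf, spline, Pi.sub_apply, sub_mul, Finset.sum_sub_distrib, φ.coe_coe]
  rw [hsub]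
  refine norm_sub_sub_fderivWithin_le (convex_triangle v) (uniqueDiffOn_triangle hv)
    ((spline_mem_splineSpace hv b c).1.of_le (by norm_num)) (fun z hz => ?_) (fun z hz => ?_) hy hx
  · exact (norm_fderivWithin_fderivWithin_le_hessian hv f hz).trans (by linarith [hH z hz])
  · rw [← dist_eq_norm]
    exact dist_le_longestEdge hz hy

theorem norm_sub_spline_domainPoint_le {b : BasisName} {K : ℝ} (hK : IsStabilityConstant b K)
    (c : Index b → ℝ) {H : ℝ} (hH : ∀ x ∈ triangle v, ‖hessian v (spline b v c) x‖ ≤ H) :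
    ‖c - fun s => spline b v c (domainPoint b v s)‖ ≤ 2 * K * longestEdge v ^ 2 * H := by
  obtain ⟨z, hz⟩ := (interior_triangle_nonempty hv).mono interior_subset
  have hH0 : 0 ≤ H := (norm_nonneg _).trans (hH z hz)
  refine (pi_norm_le_iff_of_nonneg (by have := hK.1; positivity)).2 fun s => ?_
  set d : Index b → ℝ := c - fun t => spline b v c (domainPoint b v s) +
    fderivWithin ℝ (spline b v c) (triangle v) (domainPoint b v s)
      (domainPoint b v t - domainPoint b v s) with hd
  have hstable : K⁻¹ * ‖d‖ ≤ 2 * H * longestEdge v ^ 2 :=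
    (ENNReal.ofReal_le_ofReal_iff (by positivity)).1 ((hK.2 v hv d).1.trans
      (eLpNorm_triangle_le fun x hx =>
        norm_spline_sub_tangent_le hv c hH hx (domainPoint_mem_triangle v s)))
  rw [inv_mul_le_iff₀ hK.1] at hstable
  calc ‖(c - fun t => spline b v c (domainPoint b v t)) s‖ = ‖d s‖ := by
        simp only [hd, Pi.sub_apply, sub_self, map_zero, add_zero]
    _ ≤ ‖d‖ := norm_le_pi_norm d s
    _ ≤ 2 * K * longestEdge v ^ 2 * H := by linarith

end

end PS12

theorem mainTheorem5 (b : PS12.BasisName) :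
    (∃ K : ℝ, PS12.IsStabilityConstant b K ∧
      ∀ v : Fin 3 → PS12.Plane, AffineIndependent ℝ v →
        IsUnit (PS12.collocation b v).det ∧ ‖(PS12.collocation b v)⁻¹‖ = K) ∧
    ∀ K : ℝ, PS12.IsStabilityConstant b K →
      ∀ v : Fin 3 → PS12.Plane, AffineIndependent ℝ v → ∀ c : PS12.Index b → ℝ,
        PS12.spline b v c ∈ PS12.splineSpace v ∧
        ∃ H : ℝ,
          IsGreatest ((fun x => ‖PS12.hessian v (PS12.spline b v c) x‖) '' PS12.triangle v) H ∧
          ‖c - fun s => PS12.spline b v c (PS12.domainPoint b v s)‖ ≤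
            2 * K * PS12.longestEdge v ^ 2 * H := by
  constructor
  · obtain ⟨⟨v₀, hv₀, -⟩⟩ : Nonempty (AffineBasis (Fin 3) ℝ PS12.Plane) :=
      AffineBasis.exists_affineBasis_of_finiteDimensional (by simp)
    refine ⟨_, PS12.isStabilityConstant_norm_inv_collocation hv₀ b, fun v hv =>
      ⟨PS12.isUnit_det_collocation hv b, ?_⟩⟩
    rw [PS12.collocation_congr (PS12.signedArea_ne_zero hv) (PS12.signedArea_ne_zero hv₀)]
  · intro K hK v hv c
    have hspline := PS12.spline_mem_splineSpace hv b c
    obtain ⟨H, hH⟩ := PS12.exists_isGreatest_norm_hessian hv (hspline.1.of_le (by norm_num))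
    exact ⟨hspline, H, hH, PS12.norm_sub_spline_domainPoint_le hv hK c fun x hx =>
      hH.2 (Set.mem_image_of_mem _ hx)⟩
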